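/- **Notation.** Let $D_{\uparrow,1}$ (resp. $D_{\uparrow,\infty}$) be the set of non-decreasing, right-continuous functions $\xi:[0,1]\to[0,\infty)$ (resp. $\xi:[0,\infty)\to[0,\infty)$), with the $\sigma$-algebra generated by the evaluations $\xi\mapsto\xi(t)$ and with the Skorokhod $J_1$ topology. For $\xi\in D_{\uparrow,\infty}$, $d\xi$ denotes the Radon measure on $[0,\infty)$ with distribution function $\xi$, and for $t>0$, $\gamma>0$, $(\Delta_{t,\gamma}\xi)(s):=t^{-\gamma}\xi(ts)$; elements of $D_{\uparrow,\infty}$ are restricted to $[0,1]$ where an element of $D_{\uparrow,1}$ is required. $C_B(Y)$ is the space of bounded continuous real functions on $Y$, and $C_{B,c}(D_{\uparrow,1})$ is the set of bounded measurable functions $g:D_{\uparrow,1}\to\mathbb R$ that are $J_1$-continuous at every continuous $\xi\in D_{\uparrow,1}$. Let $X$ be a Polish space, $m\neq0$ a $\sigma$-finite non-atomic Borel measure on $X$, and $T:X\to X$ an $m$-preserving transformation. Suppose $T$ is weakly rationally ergodic with return sequence $a(n)>0$ and ring $R(T)$: that is, $R(T)$ is a ring of Borel sets of finite measure which is hereditary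 ($A\in R(T)$ and $B\subset A$ Borel imply $B\in R(T)$), $T$-invariant ($A\in R(T)$ implies $T^{-1}A\in R(T)$) and dense (every Borel set of finite measure is approximated in measure by members of $R(T)$), and $$\frac1{a(n)}\sum_{k=0}^{n-1}m(A\cap T^{-k}B)\xrightarrow[n\to\infty]{}m(A)m(B)\qquad\forall\,A,B\in R(T).$$ Suppose that $a$ is $\gamma$-regularly varying with $\gamma\in(0,1]$, i.e. $a(\lfloor cn\rfloor)/a(n)\to c^\gamma$ for all $c>0$. For $f\in L^1(m)_+$ write $m(f)=\int_Xf\,dm$, $S_n(f)=\sum_{k=0}^{n-1}f\circ T^k$ and $\Psi_{n,f}(t):=S_{\lfloor nt\rfloor}(f)/a(n)$. **Proposition 4.** Let $\mathtt m_\gamma$ be a random variable in $D_{\uparrow,\infty}$ which is a.s. continuous with $\mathtt m_\gamma(0)=0$ a.s., and suppose that for every $f\in L^1(m)_+$, $\Psi_{n,f}\to m(f)\,\mathtt m_\gamma$ in distribution in $(D_{\uparrow,\infty},J_1)$ with respect to every $m$-absolutely continuous probability on $X$. Then there is a random variable $\mathtt w(\mathtt m_\gamma)$ in $D_{\uparrow,1}$,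 unique in law, with $$\mathbb E\,h(\mathtt w(\mathtt m_\gamma))=\mathbb E\int_0^1h(\Delta_{t,\gamma}\mathtt m_\gamma)\,d\mathtt m_\gamma(t)\qquad\forall\,h\in C_B(D_{\uparrow,1},J_1),$$ and for all $A,B\in R(T)$, $f\in L^1(m)_+$ and $g\in C_{B,c}(D_{\uparrow,1})$, $$\frac1{a(n)}\sum_{k=1}^n\int_Ag(\Psi_{k,f})\,1_B\circ T^k\,dm\xrightarrow[n\to\infty]{}m(A)\,m(B)\,\mathbb E\,g\big(m(f)\,\mathtt w(\mathtt m_\gamma)\big).$$ -/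

import Mathlib

open Set Filter Topology MeasureTheory
open scoped NNReal ENNReal BoundedContinuousFunction

noncomputable section

namespace TiedDown

/-- Non-decreasing, right-continuous functions `I → [0,∞)`, for an interval `I`: the distribution
functions of the Radon measures on `I`. -/
@[ext]
structure NonDec (I : Type*) [LinearOrder I] [TopologicalSpace I] where
  toFun : I → ℝ≥0
  mono : Monotone toFun
  right_cont : ∀ x, ContinuousWithinAt toFun (Ici x) x

instance (I : Type*) [LinearOrder I] [TopologicalSpace I] :
    CoeFun (NonDec I) (fun _ => I → ℝ≥0) := ⟨NonDec.toFun⟩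

/-- The interval `[0,1]`. -/
abbrev UnitI : Type := Icc (0 : ℝ≥0) 1

/-- The space `D_{↑,1}`. -/
abbrev DOne : Type := NonDec UnitI

/-- The space `D_{↑,∞}`. -/
abbrev DInf : Type := NonDec ℝ≥0

/-- The σ-algebra generated by the evaluations `ξ ↦ ξ t`. -/
instance (I : Type*) [LinearOrder I] [TopologicalSpace I] : MeasurableSpace (NonDec I) :=
  ⨆ t : I, MeasurableSpace.comap (fun ξ : NonDec I => ξ t) inferInstance

/-! ### The Skorokhod `J₁` topologies -/

/-- `‖log ℓ'‖_∞` of an increasing bijection `ℓ`, as the supremum of `|log|` of its slopes;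
it is finite exactly when `ℓ` is bi-Lipschitz. -/
def logSlope {I : Type*} [LinearOrder I] (coord : I → ℝ≥0) (ℓ : I ≃o I) : ℝ≥0∞ :=
  ⨆ (s : I) (t : I) (_ : s < t), ENNReal.ofReal
    |Real.log (((coord (ℓ t) : ℝ) - coord (ℓ s)) / ((coord t : ℝ) - coord s))|

/-- The `J₁` metric on `D_{↑,1}`. -/
def distOne (ξ η : DOne) : ℝ≥0∞ :=
  ⨅ ℓ : UnitI ≃o UnitI, (⨆ t : UnitI, edist (ξ t) (η (ℓ t))) + logSlope (fun t : UnitI => (t : ℝ≥0)) ℓ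

/-- The `J₁` metric on `D_{↑,∞}`. -/
def distInf (ξ η : DInf) : ℝ≥0∞ :=
  ⨅ ℓ : ℝ≥0 ≃o ℝ≥0, logSlope (fun t => t) ℓ +
    ∫⁻ u in Ici (0 : ℝ), ENNReal.ofReal (Real.exp (-u)) *
      min (⨆ t : ℝ≥0, edist (ξ (min t u.toNNReal)) (η (min (ℓ t) u.toNNReal))) 1

/-- The topology whose open sets are those containing a `d`-ball around each of their points. -/
@[reducible]
def ballTopology {E : Type*} (d : E → E → ℝ≥0∞) : TopologicalSpace E where
  IsOpen U := ∀ ξ ∈ U, ∃ ε : ℝ≥0∞, 0 < ε ∧ ∀ η, d ξ η < ε → η ∈ U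
  isOpen_univ := fun _ _ => ⟨1, one_pos, fun _ _ => mem_univ _⟩
  isOpen_inter := by
    intro U V hU hV ξ hξ
    obtain ⟨ε, hε, h⟩ := hU ξ hξ.1
    obtain ⟨δ, hδ, h'⟩ := hV ξ hξ.2
    exact ⟨min ε δ, lt_min hε hδ, fun η hη =>
      ⟨h η (hη.trans_le (min_le_left _ _)), h' η (hη.trans_le (min_le_right _ _))⟩⟩
  isOpen_sUnion := by
    intro S hS ξ hξ
    obtain ⟨U, hU, hξU⟩ := hξ
    obtain ⟨ε, hε, h⟩ := hS U hU ξ hξU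
    exact ⟨ε, hε, fun η hη => ⟨U, hU, h η hη⟩⟩

instance : TopologicalSpace DOne := ballTopology distOne

instance : TopologicalSpace DInf := ballTopology distInf

/-! ### Operations on non-decreasing functions -/

/-- The restriction of `ξ ∈ D_{↑,∞}` to `[0,1]`. -/
def NonDec.toOne (ξ : DInf) : DOne where
  toFun t := ξ (t : ℝ≥0)
  mono := fun _ _ h => ξ.mono h
  right_cont := fun x =>
    (ξ.right_cont (x : ℝ≥0)).comp continuous_subtype_val.continuousWithinAt (fun _ h => h)

/-- The multiple `c ξ`. -/
def NonDec.scale {I : Type*} [LinearOrder I] [TopologicalSpace I] (c : ℝ≥0) (ξ : NonDec I) :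
    NonDec I where
  toFun t := c * ξ t
  mono := fun _ _ h => mul_le_mul_right (ξ.mono h) c
  right_cont := fun x => (ξ.right_cont x).const_mul c

/-- The scaling `(Δ_{a,γ} ξ)(t) = ξ (a t) / a ^ γ`. -/
def NonDec.dilate (γ : ℝ) (a : ℝ≥0) (ξ : DInf) : DInf where
  toFun t := ξ (a * t) / a ^ γ
  mono := fun _ _ h => by
    exact div_le_div_of_nonneg_right (ξ.mono (mul_le_mul_right h a)) zero_le
  right_cont := fun x => by
    have h : ContinuousWithinAt (fun t : ℝ≥0 => a * t) (Ici x) x := by fun_prop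
    have h' := (ξ.right_cont (a * x)).comp h (fun _ ht => mul_le_mul_right ht a)
    exact h'.div_const _

/-- The Radon measure `μ` on `[0,∞)` with `μ [0,t] = ξ t` for all `t`. -/
def NonDec.measure (ξ : DInf) : Measure ℝ≥0 :=
  (ξ 0 : ℝ≥0∞) • Measure.dirac 0 +
    (StieltjesFunction.mk (fun t : ℝ≥0 => (ξ t : ℝ)) (fun _ _ h => ξ.mono h)
      (fun x => NNReal.continuous_coe.continuousAt.comp_continuousWithinAt
        (ξ.right_cont x))).measure

/-- Bounded measurable functions on `D_{↑,1}` that are `J₁`-continuous at each continuous `ξ`. -/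
structure IsCBc (g : DOne → ℝ) : Prop where
  measurable : Measurable g
  bounded : ∃ C : ℝ, ∀ ξ, |g ξ| ≤ C
  continuousAt : ∀ ξ : DOne, Continuous ξ.toFun → ContinuousAt g ξ

/-! ### Ergodic theory -/

theorem floor_right_cont (n : ℕ) (F : ℕ → ℝ≥0) (x : ℝ≥0) :
    ContinuousWithinAt (fun t : ℝ≥0 => F ⌊(n : ℝ≥0) * t⌋₊) (Ici x) x := by
  refine ContinuousWithinAt.congr_of_eventuallyEq
    (continuousWithinAt_const (b := F ⌊(n : ℝ≥0) * x⌋₊)) ?_ rfl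
  have hlt : (n : ℝ≥0) * x < (⌊(n : ℝ≥0) * x⌋₊ : ℝ≥0) + 1 := Nat.lt_floor_add_one _
  have hc : Continuous fun t : ℝ≥0 => (n : ℝ≥0) * t := by fun_prop
  filter_upwards [mem_nhdsWithin_of_mem_nhds (hc.continuousAt.eventually_lt
    continuousAt_const hlt), self_mem_nhdsWithin] with t ht hxt
  congr 1
  refine (Nat.floor_eq_iff zero_le).2 ⟨?_, ht⟩
  exact (Nat.floor_le zero_le).trans (mul_le_mul_right hxt _)

/-- The normalized Birkhoff-sum step function `Ψ_{n,f}(t) = S_{⌊nt⌋}(f) / a(n)` at the point `x`. -/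
def Psi {X : Type*} (T : X → X) (a : ℕ → ℝ≥0) (f : X → ℝ≥0) (n : ℕ) (x : X) : DInf where
  toFun t := birkhoffSum T f ⌊(n : ℝ≥0) * t⌋₊ x / a n
  mono := fun s t h => by
    have h1 : ⌊(n : ℝ≥0) * s⌋₊ ≤ ⌊(n : ℝ≥0) * t⌋₊ := Nat.floor_mono (mul_le_mul_right h _)
    have h2 : birkhoffSum T f ⌊(n : ℝ≥0) * s⌋₊ x ≤ birkhoffSum T f ⌊(n : ℝ≥0) * t⌋₊ x :=
      Finset.sum_le_sum_of_subset (Finset.range_mono h1)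
    exact div_le_div_of_nonneg_right h2 zero_le
  right_cont := fun x' => floor_right_cont n (fun k => birkhoffSum T f k x / a n) x'

/-- `(X,m,T)` is a weakly rationally ergodic measure preserving transformation with return
sequence `a` and with `R` as its dense, `T`-invariant, hereditary ring `R(T)`. -/
structure IsWeaklyRationallyErgodic {X : Type*} [MeasurableSpace X] (m : Measure X) (T : X → X)
    (a : ℕ → ℝ≥0) (R : Set (Set X)) : Prop where
  measurePreserving : MeasurePreserving T m m
  measurableSet : ∀ A ∈ R, MeasurableSet A
  measure_lt_top : ∀ A ∈ R, m A < ∞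
  ring : IsSetRing R
  hereditary : ∀ A ∈ R, ∀ B, MeasurableSet B → B ⊆ A → B ∈ R
  invariant : ∀ A ∈ R, T ⁻¹' A ∈ R
  dense : ∀ E, MeasurableSet E → m E < ∞ → ∀ ε : ℝ≥0∞, 0 < ε → ∃ A ∈ R, m (symmDiff A E) < ε
  pos : ∀ n, 1 ≤ n → 0 < a n
  tendsto : ∀ A ∈ R, ∀ B ∈ R,
    Tendsto (fun n : ℕ => 1 / (a n : ℝ) * ∑ k ∈ Finset.range n, m.real (A ∩ T^[k] ⁻¹' B))
      atTop (𝓝 (m.real A * m.real B))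

/-- The sequence `a` is regularly varying with index `γ`. -/
def IsRegularlyVarying (γ : ℝ) (a : ℕ → ℝ≥0) : Prop :=
  ∀ c : ℝ, 0 < c → Tendsto (fun n : ℕ => (a ⌊c * n⌋₊ : ℝ) / a n) atTop (𝓝 (c ^ γ))

/-- `f` is (a representative of) an element of `L¹(m)₊`. -/
def IsL1Pos {X : Type*} [MeasurableSpace X] (m : Measure X) (f : X → ℝ≥0) : Prop :=
  Measurable f ∧ ∫⁻ x, f x ∂m < ∞

/-- `m(f) = ∫ f dm`. -/
def integ {X : Type*} [MeasurableSpace X] (m : Measure X) (f : X → ℝ≥0) : ℝ≥0 :=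
  (∫⁻ x, f x ∂m).toNNReal

/-- Convergence `Y_n → Z` in distribution in `(D_{↑,∞}, J₁)` with respect to all `m`-absolutely
continuous probabilities, where `Z` is a random variable on `(Ω, P)`. -/
def StrongDistConv {X Ω : Type*} [MeasurableSpace X] [MeasurableSpace Ω] (m : Measure X)
    (Y : ℕ → X → DInf) (P : Measure Ω) (Z : Ω → DInf) : Prop :=
  ∀ Q : Measure X, IsProbabilityMeasure Q → Q ≪ m → ∀ F : DInf →ᵇ ℝ,
    Tendsto (fun n => ∫ x, F (Y n x) ∂Q) atTop (𝓝 (∫ ω, F (Z ω) ∂P))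

/-- `W` is the law of `w(M)`:
`E h(w(M)) = E ∫₀¹ h(Δ_{t,γ} M) dM(t)` for all bounded `J₁`-continuous `h` on `D_{↑,1}`. -/
def IsTiedDownLaw {Ω : Type*} [MeasurableSpace Ω] (γ : ℝ) (P : Measure Ω) (M : Ω → DInf)
    (W : ProbabilityMeasure DOne) : Prop :=
  ∀ h : DOne →ᵇ ℝ, ∫ ξ, h ξ ∂(W : Measure DOne) =
    ∫ ω, ∫ t in Icc (0 : ℝ≥0) 1, h ((M ω).dilate γ t).toOne ∂(M ω).measure ∂P

end TiedDown

end

open TiedDown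

/-!
By regular variation `Ψ_{k,f}` is close to `Δ_{t,γ} Ψ_{n,f}` for `k = ⌊nt⌋`, so the normalized sum
is close to the integral over `A` of `∫₀¹ g (Δ_{t,γ} Ψ_{n,f}) dΨ_{n,1_B}(t)`. The occupation times
`Ψ_{n,f}` and `Ψ_{n,1_B}` converge jointly, to `m(f) M` and `m(B) M`: the limit of
`E exp (-∫ Ψ_{n,f+f'})` depends only on `m(f) + m(f')`, so if `m(f) = m(f')`, then
`exp (-∫ Ψ_{n,f})` and `exp (-∫ Ψ_{n,f'})` are asymptotically equal in `L²`. When `g ≥ 0`, the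
integral `∫₀¹ g (Δ_{t,γ} Ψ_{n,f}) dΨ_{n,1_B}(t)` is lower semicontinuous along occupation times with
a continuous limit, and Fatou's lemma for convergence in distribution bounds the sums from below.

Applied to `C + g` and to `C - g`, the lower bound gives convergence as soon as the total masses
converge to the mass `m(A) m(B) E M(1)` of the limit. By weak rational ergodicity they converge to
`m(A) m(B)`, so what is needed is `E M(1) = 1`. Here `E M(1) ≤ 1` is Fatou's lemma again, and
equality holds because `Ψ_{n,1_A}(1)` is uniformly integrable over `A`: its integrals over all
measurable subsets of `A` converge.
-/

noncomputable section

namespace TiedDown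

open TopologicalSpace (denseSeq denseRange_denseSeq)

/-! ### Primitives of non-decreasing functions -/

/-- The primitive `q ↦ ∫₀^q ξ`. Unlike evaluation at a point, it is `J₁`-continuous in `ξ`. -/
def NonDec.primitive (ξ : DInf) (q : ℝ≥0) : ℝ := ∫ s in (0 : ℝ)..q, (ξ s.toNNReal : ℝ)

section Primitive

variable (ξ η : DInf) (q : ℝ≥0)

theorem NonDec.monotone_toNNReal : Monotone fun s : ℝ => (ξ s.toNNReal : ℝ) :=
  fun _ _ h => NNReal.coe_le_coe.2 (ξ.mono (Real.toNNReal_mono h))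

theorem NonDec.intervalIntegrable_toNNReal (a b : ℝ) :
    IntervalIntegrable (fun s : ℝ => (ξ s.toNNReal : ℝ)) volume a b :=
  ξ.monotone_toNNReal.intervalIntegrable

theorem NonDec.primitive_sub (p : ℝ≥0) :
    ξ.primitive q - ξ.primitive p = ∫ s in (p : ℝ)..q, (ξ s.toNNReal : ℝ) :=
  intervalIntegral.integral_interval_sub_left (ξ.intervalIntegrable_toNNReal _ _)
    (ξ.intervalIntegrable_toNNReal _ _)

theorem NonDec.mul_le_primitive_sub {p q : ℝ≥0} (h : p ≤ q) :
    ((q : ℝ) - p) * ξ p ≤ ξ.primitive q - ξ.primitive p := by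
  rw [primitive_sub]
  simpa using intervalIntegral.integral_mono_on (μ := volume) (NNReal.coe_le_coe.2 h)
    (intervalIntegrable_const (c := (ξ p : ℝ))) (ξ.intervalIntegrable_toNNReal _ _)
    fun s hs => by simpa using ξ.monotone_toNNReal hs.1

theorem NonDec.primitive_sub_le_mul {p q : ℝ≥0} (h : p ≤ q) :
    ξ.primitive q - ξ.primitive p ≤ ((q : ℝ) - p) * ξ q := by
  rw [primitive_sub]
  simpa using intervalIntegral.integral_mono_on (μ := volume) (NNReal.coe_le_coe.2 h)
    (ξ.intervalIntegrable_toNNReal _ _) (intervalIntegrable_const (c := (ξ q : ℝ)))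
    fun s hs => by simpa using ξ.monotone_toNNReal hs.2

theorem NonDec.primitive_nonneg : 0 ≤ ξ.primitive q :=
  intervalIntegral.integral_nonneg q.2 fun _ _ => NNReal.coe_nonneg _

theorem NonDec.primitive_scale (c : ℝ≥0) : (ξ.scale c).primitive q = c * ξ.primitive q := by
  simp [primitive, scale]

theorem NonDec.continuous_primitive : Continuous ξ.primitive :=
  (intervalIntegral.continuous_primitive ξ.intervalIntegrable_toNNReal 0).comp
    NNReal.continuous_coe

variable {ξ η q}

theorem NonDec.primitive_le_of_forall_le {c e : ℝ≥0} (hc : 0 < c)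
    (h : ∀ s ≤ q, η s ≤ ξ (c * s) + e) :
    η.primitive q ≤ (c : ℝ)⁻¹ * ξ.primitive (c * q) + q * e := by
  have hc' : (0 : ℝ) < c := hc
  have hξc : IntervalIntegrable (fun s : ℝ => (ξ (c * s).toNNReal : ℝ)) volume 0 q :=
    (ξ.monotone_toNNReal.comp (monotone_mul_left_of_nonneg c.2)).intervalIntegrable
  calc η.primitive q
      ≤ ∫ s in (0 : ℝ)..q, ((ξ (c * s).toNNReal : ℝ) + e) := by
        refine intervalIntegral.integral_mono_on q.2 (η.intervalIntegrable_toNNReal _ _)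
          (hξc.add intervalIntegrable_const) fun s hs => ?_
        simpa [Real.toNNReal_mul c.coe_nonneg] using
          NNReal.coe_le_coe.2 (h s.toNNReal (Real.toNNReal_le_iff_le_coe.2 hs.2))
    _ = (c : ℝ)⁻¹ * ξ.primitive (c * q) + q * e := by
        rw [intervalIntegral.integral_add hξc intervalIntegrable_const,
          intervalIntegral.integral_comp_mul_left (fun s => (ξ s.toNNReal : ℝ)) hc'.ne']
        simp [primitive]

/-- Mutual domination on `[0,q]` up to a factor `1 + e` in time and an additive `e`. This is what
`J₁`-closeness gives, and all that is needed to compare primitives. -/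
def NonDec.Near (e q : ℝ≥0) (ξ η : DInf) : Prop :=
  ∀ s ≤ q, η s ≤ ξ ((1 + e) * s) + e ∧ ξ s ≤ η ((1 + e) * s) + e

variable (ξ q)

theorem NonDec.exists_near_imp_abs_primitive_sub_lt {ε : ℝ} (hε : 0 < ε) :
    ∃ e ∈ Ioo (0 : ℝ≥0) 1, ∀ η, NonDec.Near e q ξ η → |η.primitive q - ξ.primitive q| < ε := by
  have hup : ContinuousAt
      (fun e : ℝ≥0 => ((1 + e : ℝ≥0) : ℝ)⁻¹ * ξ.primitive ((1 + e) * q) + q * e) 0 := by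
    have := ξ.continuous_primitive
    fun_prop (disch := simp)
  have hlow : ContinuousAt
      (fun e : ℝ≥0 => ((1 + e : ℝ≥0) : ℝ) * ξ.primitive ((1 + e)⁻¹ * q) - q * e) 0 := by
    have := ξ.continuous_primitive
    fun_prop (disch := simp)
  obtain ⟨e, ⟨hup_e, hlow_e⟩, he⟩ := (((hup.eventually_lt_const (u := ξ.primitive q + ε)
    (by simpa)).and (hlow.eventually_const_lt (u := ξ.primitive q - ε)
    (by simpa))).filter_mono nhdsWithin_le_nhds |>.and
    (Ioo_mem_nhdsGT zero_lt_one)).exists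
  refine ⟨e, he, fun η hη => abs_sub_lt_iff.2 ⟨?_, ?_⟩⟩
  · have := primitive_le_of_forall_le (by positivity) fun s hs => (hη s hs).1
    linarith
  · have hle : (1 + e)⁻¹ * q ≤ q := mul_le_of_le_one_left' (inv_le_one_of_one_le₀ (by simp))
    have h := primitive_le_of_forall_le (c := 1 + e) (by positivity)
      fun s (hs : s ≤ (1 + e)⁻¹ * q) => (hη s (hs.trans hle)).2
    rw [mul_inv_cancel_left₀ (by positivity)] at h
    have hpos : (0 : ℝ) < (1 + e : ℝ≥0) := by positivity
    have h' := mul_le_mul_of_nonneg_left h hpos.le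
    push_cast at h' hpos hlow_e
    have hcancel : (1 + (e : ℝ)) * ((1 + (e : ℝ))⁻¹ * η.primitive q + (1 + (e : ℝ))⁻¹ * q * e)
      = η.primitive q + q * e := by field_simp
    linarith

end Primitive

/-! ### Continuity for the Skorokhod topologies -/

theorem continuous_of_ballTopology {E F : Type*} [PseudoMetricSpace F] {d : E → E → ℝ≥0∞}
    {φ : E → F} (h : ∀ ξ, ∀ ε > 0, ∃ δ : ℝ≥0∞, 0 < δ ∧ ∀ η, d ξ η < δ → dist (φ η) (φ ξ) < ε) :
    Continuous[ballTopology d, inferInstance] φ := by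
  let _ : TopologicalSpace E := ballTopology d
  refine ⟨fun U hU ξ hξ => ?_⟩
  obtain ⟨ε, hε, hU'⟩ := Metric.isOpen_iff.1 hU _ hξ
  obtain ⟨δ, hδ, h'⟩ := h ξ ε hε
  exact ⟨δ, hδ, fun η hη => hU' (h' η hη)⟩

section TimeChange

variable {I : Type*} [LinearOrder I] [OrderBot I] {coord : I → ℝ≥0} {ℓ : I ≃o I} {c : ℝ≥0}

theorem le_mul_of_logSlope_le (hcoord : StrictMono coord) (hbot : coord ⊥ = 0) (hc : 1 ≤ c)
    (h : logSlope coord ℓ ≤ ENNReal.ofReal (Real.log c)) (t : I) :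
    coord (ℓ t) ≤ c * coord t ∧ coord t ≤ c * coord (ℓ t) := by
  rcases eq_bot_or_bot_lt t with rfl | ht
  · simp [hbot]
  have hpos : ∀ {t}, ⊥ < t → (0 : ℝ) < coord t := fun ht => by
    exact_mod_cast hbot ▸ hcoord ht
  have hx := hpos ht
  have hy := hpos (ℓ.map_bot ▸ ℓ.lt_iff_lt.2 ht)
  have hc0 : (0 : ℝ) < c := zero_lt_one.trans_le (by exact_mod_cast hc)
  have hslope : |Real.log (coord (ℓ t) / coord t)| ≤ Real.log c := by
    have := (le_iSup₂_of_le ⊥ t (le_iSup_of_le ht le_rfl) :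
      ENNReal.ofReal |Real.log (((coord (ℓ t) : ℝ) - coord (ℓ ⊥)) / ((coord t : ℝ) - coord ⊥))|
        ≤ logSlope coord ℓ).trans h
    rw [ENNReal.ofReal_le_ofReal_iff (Real.log_nonneg (by exact_mod_cast hc))] at this
    simpa [hbot] using this
  rw [abs_le', ← Real.log_inv, inv_div, Real.log_le_log_iff (by positivity) hc0,
    Real.log_le_log_iff (by positivity) hc0, div_le_iff₀ hx, div_le_iff₀ hy] at hslope
  exact_mod_cast hslope

end TimeChange

theorem near_of_timeChange {ξ η : DInf} {ℓ : ℝ≥0 ≃o ℝ≥0} {e q u : ℝ≥0}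
    (hℓ : logSlope (fun t => t) ℓ ≤ ENNReal.ofReal (Real.log (1 + e)))
    (hu : (1 + e) * q ≤ u) (h : ∀ t, edist (ξ (min t u)) (η (min (ℓ t) u)) ≤ e) :
    NonDec.Near e q ξ η := by
  have hslope := le_mul_of_logSlope_le (c := 1 + e) strictMono_id rfl (by simp)
    (by simpa [Function.id_def] using hℓ)
  intro s hs
  have hcs : (1 + e) * s ≤ u := (mul_le_mul_right hs _).trans hu
  have hsu : s ≤ u := (le_mul_of_one_le_left' (by simp)).trans hcs
  have hdist : ∀ t ≤ u, ℓ t ≤ u → nndist (ξ t) (η (ℓ t)) ≤ e := fun t ht hℓt => by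
    have := h t
    rwa [min_eq_left ht, min_eq_left hℓt, edist_nndist, ENNReal.coe_le_coe] at this
  constructor
  · have ht : ℓ.symm s ≤ (1 + e) * s := by simpa using (hslope (ℓ.symm s)).2
    have hd := hdist (ℓ.symm s) (ht.trans hcs) (by simpa using hsu)
    rw [OrderIso.apply_symm_apply, nndist_comm] at hd
    exact (NNReal.le_add_nndist _ _).trans (add_le_add (ξ.mono ht) hd)
  · have ht : ℓ s ≤ (1 + e) * s := (hslope s).1
    exact (NNReal.le_add_nndist _ _).trans
      (add_le_add (η.mono ht) (hdist s hsu (ht.trans hcs)))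

theorem exists_iSup_edist_le_of_lintegral_lt {D : ℝ → ℝ≥0∞} {e r : ℝ≥0} (he : e < 1)
    (h : ∫⁻ u in Ici (0 : ℝ), ENNReal.ofReal (Real.exp (-u)) * min (D u) 1 <
      ENNReal.ofReal (Real.exp (-(r + 1))) * e) :
    ∃ u ≥ (r : ℝ), D u ≤ e := by
  by_contra! hD
  refine h.not_ge ?_
  calc ENNReal.ofReal (Real.exp (-(r + 1))) * e
      = ∫⁻ _ in Icc (r : ℝ) (r + 1), ENNReal.ofReal (Real.exp (-(r + 1))) * e := by simp
    _ ≤ ∫⁻ u in Icc (r : ℝ) (r + 1), ENNReal.ofReal (Real.exp (-u)) * min (D u) 1 := by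
        refine setLIntegral_mono' measurableSet_Icc fun u hu => ?_
        gcongr
        · exact hu.2
        · exact le_min (hD u hu.1).le (by exact_mod_cast he.le)
    _ ≤ _ := lintegral_mono_set fun u hu => r.2.trans hu.1

theorem continuous_primitive_apply (q : ℝ≥0) : Continuous fun ξ : DInf => ξ.primitive q := by
  refine continuous_of_ballTopology fun ξ ε hε => ?_
  obtain ⟨e, ⟨he, he1⟩, hnear⟩ := ξ.exists_near_imp_abs_primitive_sub_lt q hε
  set r : ℝ≥0 := (1 + e) * q
  refine ⟨min (ENNReal.ofReal (Real.log (1 + e))) (ENNReal.ofReal (Real.exp (-(r + 1))) * e),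
    lt_min (by simpa using Real.log_pos (by simpa)) (by positivity), fun η hη => hnear η ?_⟩
  obtain ⟨ℓ, hℓ⟩ := iInf_lt_iff.1 hη
  obtain ⟨u, hu, hsup⟩ := exists_iSup_edist_le_of_lintegral_lt he1
    ((le_add_self.trans_lt hℓ).trans_le (min_le_right _ _))
  exact near_of_timeChange ((le_self_add.trans_lt hℓ).le.trans (min_le_left _ _))
    (NNReal.le_toNNReal_of_coe_le hu) (iSup_le_iff.1 hsup)

/-- The extension of `ξ ∈ D_{↑,1}` to `[0,∞)` which is constant on `[1,∞)`. -/
def NonDec.extend (ξ : DOne) : DInf where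
  toFun t := ξ (projIcc 0 1 zero_le_one t)
  mono := fun _ _ h => ξ.mono (monotone_projIcc _ h)
  right_cont := fun _ => (ξ.right_cont _).comp continuous_projIcc.continuousWithinAt
    fun _ h => mem_Ici.2 (monotone_projIcc _ h)

theorem near_extend_of_timeChange {ξ η : DOne} {ℓ : UnitI ≃o UnitI} {e : ℝ≥0} (q : ℝ≥0)
    (hℓ : logSlope (fun t : UnitI => (t : ℝ≥0)) ℓ ≤ ENNReal.ofReal (Real.log (1 + e)))
    (h : ∀ t, edist (ξ t) (η (ℓ t)) ≤ e) :
    NonDec.Near e q ξ.extend η.extend := by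
  have hslope := le_mul_of_logSlope_le (c := 1 + e) (Subtype.strictMono_coe _) rfl (by simp)
    (by simpa using hℓ)
  have hdist : ∀ t, nndist (ξ t) (η (ℓ t)) ≤ e := fun t => by
    have := h t
    rwa [edist_nndist, ENNReal.coe_le_coe] at this
  have hproj : ∀ {t : UnitI} {s : ℝ≥0}, (t : ℝ≥0) ≤ (1 + e) * projIcc 0 1 zero_le_one s →
      t ≤ projIcc 0 1 zero_le_one ((1 + e) * s) := fun {t s} ht => by
    rw [← projIcc_val zero_le_one t]
    refine monotone_projIcc _ (ht.trans (mul_le_mul_right ?_ _))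
    simp [coe_projIcc]
  intro s _
  dsimp only [NonDec.extend]
  constructor
  · have ht := hproj (t := ℓ.symm (projIcc 0 1 zero_le_one s)) (s := s)
      (by simpa using (hslope (ℓ.symm _)).2)
    have hd := hdist (ℓ.symm (projIcc 0 1 zero_le_one s))
    rw [OrderIso.apply_symm_apply, nndist_comm] at hd
    exact (NNReal.le_add_nndist _ _).trans (add_le_add (ξ.mono ht) hd)
  · exact (NNReal.le_add_nndist _ _).trans
      (add_le_add (η.mono (hproj (hslope (projIcc 0 1 zero_le_one s)).1)) (hdist _))

theorem continuous_primitive_extend_apply (q : ℝ≥0) :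
    Continuous fun ξ : DOne => ξ.extend.primitive q := by
  refine continuous_of_ballTopology fun ξ ε hε => ?_
  obtain ⟨e, ⟨he, -⟩, hnear⟩ := ξ.extend.exists_near_imp_abs_primitive_sub_lt q hε
  refine ⟨min (ENNReal.ofReal (Real.log (1 + e))) e,
    lt_min (by simpa using Real.log_pos (by simpa)) (by positivity), fun η hη => hnear _ ?_⟩
  obtain ⟨ℓ, hℓ⟩ := iInf_lt_iff.1 hη
  exact near_extend_of_timeChange q ((le_add_self.trans_lt hℓ).le.trans (min_le_left _ _))
    (iSup_le_iff.1 ((le_self_add.trans_lt hℓ).le.trans (min_le_right _ _)))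

theorem distOne_le_iSup_edist (ξ η : DOne) : distOne ξ η ≤ ⨆ t : UnitI, edist (ξ t) (η t) := by
  refine (iInf_le _ (OrderIso.refl _)).trans ?_
  have hslope : logSlope (fun t : UnitI => (t : ℝ≥0)) (OrderIso.refl _) = 0 := by
    simp only [logSlope, ENNReal.iSup_eq_zero]
    intro s t hst
    have : ((t : ℝ≥0) : ℝ) - (s : ℝ≥0) ≠ 0 :=
      sub_ne_zero.2 fun h => hst.ne' (Subtype.ext (NNReal.coe_injective h))
    simp [div_self this]
  simp [hslope]

theorem tendsto_nhds_of_tendstoUniformly {ι : Type*} {l : Filter ι} {ξ : ι → DOne} {η : DOne}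
    (h : TendstoUniformly (fun i => (ξ i).toFun) η.toFun l) : Tendsto ξ l (𝓝 η) := by
  rw [tendsto_nhds]
  intro U hU hη
  obtain ⟨ε, hε, hU'⟩ := hU η hη
  obtain ⟨δ, hδ, hδε⟩ := exists_between hε
  filter_upwards [EMetric.tendstoUniformly_iff.1 h δ hδ] with i hi
  exact hU' _ (((distOne_le_iSup_edist _ _).trans (iSup_le fun t => (hi t).le)).trans_lt hδε)

/-! ### Convergence of monotone functions -/

theorem tendsto_apply_of_monotone {ι α β : Type*} [LinearOrder α] [TopologicalSpace α]
    [OrderTopology α] [LinearOrder β] [TopologicalSpace β] [OrderTopology β] {L : Filter ι}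
    {F : ι → α → β} {f : α → β} {u : ι → α} {t : α} (hF : ∀ j, Monotone (F j))
    (hFf : ∀ᶠ s in 𝓝 t, Tendsto (fun j => F j s) L (𝓝 (f s))) (hf : ContinuousAt f t)
    (hu : Tendsto u L (𝓝 t)) : Tendsto (fun j => F j (u j)) L (𝓝 (f t)) := by
  refine tendsto_order.2 ⟨fun c hc => ?_, fun c hc => ?_⟩
  · obtain ⟨a, b, ht, hab, hsub⟩ :=
      exists_Icc_mem_subset_of_mem_nhds (hFf.and (hf.eventually_const_lt hc))
    obtain ⟨ha, hca⟩ := hsub ⟨le_rfl, ht.1.trans ht.2⟩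
    filter_upwards [ha.eventually_const_lt hca, hu hab] with j hj huj
      using hj.trans_le (hF j huj.1)
  · obtain ⟨a, b, ht, hab, hsub⟩ :=
      exists_Icc_mem_subset_of_mem_nhds (hFf.and (hf.eventually_lt_const hc))
    obtain ⟨hb, hbc⟩ := hsub ⟨ht.1.trans ht.2, le_rfl⟩
    filter_upwards [hb.eventually_lt_const hbc, hu hab] with j hj huj
      using (hF j huj.2).trans_lt hj

theorem tendsto_nhds_of_forall_tendsto_apply {ι : Type*} {L : Filter ι} {ξ : ι → DOne} {η : DOne}
    (hη : Continuous η.toFun) (h : ∀ t, Tendsto (fun j => ξ j t) L (𝓝 (η t))) :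
    Tendsto ξ L (𝓝 η) := by
  refine tendsto_nhds_of_tendstoUniformly ?_
  rw [← tendstoLocallyUniformly_iff_tendstoUniformly_of_compactSpace,
    tendstoLocallyUniformly_iff_forall_tendsto]
  intro t
  have hξ : Tendsto (fun p : ι × UnitI => ξ p.1 p.2) (L ×ˢ 𝓝 t) (𝓝 (η t)) :=
    tendsto_apply_of_monotone (fun p => (ξ p.1).mono) (.of_forall fun s =>
      (h s).comp tendsto_fst) hη.continuousAt tendsto_snd
  exact (((hη.tendsto t).comp tendsto_snd).prodMk_nhds hξ).mono_right (nhds_le_uniformity _)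

/-! ### Measurability and Laplace coordinates -/

theorem measurable_eval {I : Type*} [LinearOrder I] [TopologicalSpace I] (t : I) :
    Measurable fun ξ : NonDec I => ξ t :=
  Measurable.of_comap_le (le_iSup (fun t : I =>
    MeasurableSpace.comap (fun ξ : NonDec I => ξ t) inferInstance) t)

theorem measurable_of_eval {I α : Type*} [LinearOrder I] [TopologicalSpace I] [MeasurableSpace α]
    {Φ : α → NonDec I} (h : ∀ t, Measurable fun a => Φ a t) : Measurable Φ := by
  refine Measurable.of_le_map (iSup_le fun t => ?_)
  rw [MeasurableSpace.comap_le_iff_le_map, MeasurableSpace.map_comp]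
  exact fun s hs => h t hs

theorem exists_denseSeq_btwn {a b : ℝ≥0} (h : a < b) :
    ∃ i, a < denseSeq ℝ≥0 i ∧ denseSeq ℝ≥0 i < b := by
  simpa using (denseRange_denseSeq ℝ≥0).exists_between h

theorem NonDec.exists_gt_lt (ξ : DInf) {t c : ℝ≥0} (h : ξ t < c) : ∃ r > t, ξ r < c := by
  obtain ⟨r, hr, htr⟩ := ((((ξ.right_cont t).eventually_lt_const h).filter_mono
    (nhdsWithin_mono t Ioi_subset_Ici_self)).and self_mem_nhdsWithin).exists
  exact ⟨r, htr, hr⟩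

theorem measurable_eval_uncurry : Measurable fun p : DInf × ℝ≥0 => p.1 p.2 := by
  refine measurable_of_Iio fun c => ?_
  have hlt : ∀ p : DInf × ℝ≥0, p.1 p.2 < c ↔
      ∃ i, p.2 < denseSeq ℝ≥0 i ∧ p.1 (denseSeq ℝ≥0 i) < c := fun p => by
    refine ⟨fun h => ?_, fun ⟨i, hi, h⟩ => (p.1.mono hi.le).trans_lt h⟩
    obtain ⟨r, hr, hrc⟩ := p.1.exists_gt_lt h
    obtain ⟨i, hi, hir⟩ := exists_denseSeq_btwn hr
    exact ⟨i, hi, (p.1.mono hir.le).trans_lt hrc⟩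
  simp only [preimage, mem_Iio, hlt, measurableSet_setOfPred]
  exact Measurable.exists fun i => (measurableSet_lt measurable_snd measurable_const).mem.and
    (measurableSet_lt ((measurable_eval _).comp measurable_fst) measurable_const).mem

theorem measurable_primitive (q : ℝ≥0) : Measurable fun ξ : DInf => ξ.primitive q := by
  have h : Measurable fun p : DInf × ℝ => (p.1 p.2.toNNReal : ℝ) :=
    (measurable_eval_uncurry.comp
      (measurable_fst.prodMk (measurable_real_toNNReal.comp measurable_snd))).coe_nnreal_real
  simp only [NonDec.primitive, intervalIntegral.integral_of_le q.coe_nonneg]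
  exact (h.stronglyMeasurable.integral_prod_right (ν := volume.restrict (Ioc (0 : ℝ) q))).measurable

/-- The Laplace coordinates `exp (-∫₀^q ξ)`, for `q` in a countable dense set: bounded
`J₁`-continuous functions which turn sums into products and determine `ξ`. -/
def lap (ξ : DInf) (i : ℕ) : unitInterval :=
  ⟨Real.exp (-ξ.primitive (denseSeq ℝ≥0 i)), (Real.exp_pos _).le,
    Real.exp_le_one_iff.2 (neg_nonpos.2 (ξ.primitive_nonneg _))⟩

theorem continuous_lap : Continuous lap :=
  continuous_pi fun _ => (continuous_primitive_apply _).neg.rexp.subtype_mk _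

theorem measurable_lap : Measurable lap :=
  measurable_pi_lambda _ fun _ => (measurable_primitive _).neg.exp.subtype_mk

theorem primitive_denseSeq_eq (ξ : DInf) (i : ℕ) :
    ξ.primitive (denseSeq ℝ≥0 i) = -Real.log (lap ξ i) := by
  simp [lap]

theorem NonDec.apply_lt_iff (ξ : DInf) (t c : ℝ≥0) :
    ξ t < c ↔ ∃ i j, t < denseSeq ℝ≥0 i ∧
      denseSeq ℝ≥0 i < denseSeq ℝ≥0 j ∧
      ξ.primitive (denseSeq ℝ≥0 j) - ξ.primitive (denseSeq ℝ≥0 i)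
        < ((denseSeq ℝ≥0 j : ℝ) - denseSeq ℝ≥0 i) * c := by
  refine ⟨fun h => ?_, fun ⟨i, j, hti, hij, h⟩ => ?_⟩
  · obtain ⟨r, htr, hr⟩ := ξ.exists_gt_lt h
    obtain ⟨i, hti, hir⟩ := exists_denseSeq_btwn htr
    obtain ⟨j, hij, hjr⟩ := exists_denseSeq_btwn hir
    exact ⟨i, j, hti, hij, (ξ.primitive_sub_le_mul hij.le).trans_lt (mul_lt_mul_of_pos_left
      (NNReal.coe_lt_coe.2 ((ξ.mono hjr.le).trans_lt hr)) (sub_pos.2 (NNReal.coe_lt_coe.2 hij)))⟩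
  · exact (ξ.mono hti.le).trans_lt (NNReal.coe_lt_coe.1 (lt_of_mul_lt_mul_left
      ((ξ.mul_le_primitive_sub hij.le).trans_lt h) (sub_nonneg.2 (NNReal.coe_le_coe.2 hij.le))))

theorem measurable_of_measurable_lap {α : Type*} [MeasurableSpace α] {Φ : α → DInf}
    (h : Measurable fun a => lap (Φ a)) : Measurable Φ := by
  have hprim : ∀ i, Measurable fun a => (Φ a).primitive (denseSeq ℝ≥0 i) :=
    fun i => by
      simp only [primitive_denseSeq_eq]
      exact ((measurable_pi_iff.1 h i).subtype_val.log).neg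
  refine measurable_of_eval fun t => measurable_of_Iio fun c => ?_
  simp only [preimage, mem_Iio, NonDec.apply_lt_iff, measurableSet_setOfPred]
  exact Measurable.exists fun i => Measurable.exists fun j => measurable_const.and
    (measurable_const.and (measurableSet_lt ((hprim j).sub (hprim i)) measurable_const).mem)

theorem tendsto_apply_of_tendsto_lap {ι : Type*} {L : Filter ι} {ξ : ι → DInf} {η : DInf}
    (hη : Continuous η.toFun) (hη0 : η 0 = 0) (h : Tendsto (fun j => lap (ξ j)) L (𝓝 (lap η)))
    (t : ℝ≥0) : Tendsto (fun j => ξ j t) L (𝓝 (η t)) := by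
  have hprim : ∀ i, Tendsto (fun j => (ξ j).primitive (denseSeq ℝ≥0 i)) L
      (𝓝 (η.primitive (denseSeq ℝ≥0 i))) := fun i => by
    simp only [primitive_denseSeq_eq]
    exact (((continuous_subtype_val.tendsto _).comp (tendsto_pi_nhds.1 h i)).log
      (Real.exp_pos _).ne').neg
  refine tendsto_order.2 ⟨fun c hc => ?_, fun c hc => ?_⟩
  · obtain ⟨r, hrt, hr⟩ : ∃ r < t, c < η r := by
      have ht : t ≠ 0 := by rintro rfl; simp [hη0] at hc
      obtain ⟨s, hs, hsub⟩ := exists_Ioc_subset_of_mem_nhds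
        (hη.continuousAt.eventually_const_lt hc) ⟨0, pos_iff_ne_zero.2 ht⟩
      obtain ⟨r, hsr, hrt⟩ := exists_between hs
      exact ⟨r, hrt, hsub ⟨hsr, hrt.le⟩⟩
    obtain ⟨i, hri, hit⟩ := exists_denseSeq_btwn hrt
    obtain ⟨k, hik, hkt⟩ := exists_denseSeq_btwn hit
    have hpos := sub_pos.2 (NNReal.coe_lt_coe.2 hik)
    have hlt := (mul_lt_mul_of_pos_left (NNReal.coe_lt_coe.2 (hr.trans_le (η.mono hri.le)))
      hpos).trans_le (η.mul_le_primitive_sub hik.le)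
    filter_upwards [((hprim k).sub (hprim i)).eventually_const_lt hlt] with j hj
    exact (NNReal.coe_lt_coe.1 (lt_of_mul_lt_mul_left
      (hj.trans_le ((ξ j).primitive_sub_le_mul hik.le)) hpos.le)).trans_le ((ξ j).mono hkt.le)
  · obtain ⟨i, k, hti, hik, hlt⟩ := (η.apply_lt_iff t c).1 hc
    filter_upwards [((hprim k).sub (hprim i)).eventually_lt_const hlt] with j hj
    exact ((ξ j).apply_lt_iff t c).2 ⟨i, k, hti, hik, hj⟩

theorem measurable_extend : Measurable NonDec.extend :=
  measurable_of_eval fun _ => measurable_eval _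

theorem continuous_lap_extend : Continuous fun ξ : DOne => lap ξ.extend :=
  continuous_pi fun _ => (continuous_primitive_extend_apply _).neg.rexp.subtype_mk _

theorem NonDec.extend_coe (ξ : DOne) (t : UnitI) : ξ.extend t = ξ t :=
  congrArg ξ.toFun (projIcc_val zero_le_one t)

theorem measurableSpace_le_comap_lap_extend :
    (inferInstance : MeasurableSpace DOne) ≤
      MeasurableSpace.comap (fun ξ : DOne => lap ξ.extend) inferInstance := by
  refine iSup_le fun t => ?_
  rw [← measurable_iff_comap_le]
  simpa only [Function.comp_def, NonDec.extend_coe] using (measurable_eval (t : ℝ≥0)).comp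
    (@measurable_of_measurable_lap _ (.comap (fun ξ : DOne => lap ξ.extend) inferInstance) _
      (comap_measurable _))

/-- Continuous functions on `DOne` are not known to be measurable; the Laplace coordinates are both
continuous and measurable, and they separate points. -/
theorem ext_of_forall_integral_boundedContinuous_eq {μ ν : Measure DOne} [IsFiniteMeasure μ]
    [IsFiniteMeasure ν] (h : ∀ f : DOne →ᵇ ℝ, ∫ ξ, f ξ ∂μ = ∫ ξ, f ξ ∂ν) : μ = ν := by
  have hm : Measurable fun ξ : DOne => lap ξ.extend := measurable_lap.comp measurable_extend
  have key : μ.map (fun ξ : DOne => lap ξ.extend) = ν.map (fun ξ : DOne => lap ξ.extend) := by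
    refine ext_of_forall_integral_eq_of_IsFiniteMeasure fun f => ?_
    rw [integral_map hm.aemeasurable f.continuous.aestronglyMeasurable,
      integral_map hm.aemeasurable f.continuous.aestronglyMeasurable]
    exact h (f.compContinuous ⟨_, continuous_lap_extend⟩)
  ext s hs
  obtain ⟨S, hS, rfl⟩ := measurableSpace_le_comap_lap_extend s hs
  rw [← Measure.map_apply hm hS, key, Measure.map_apply hm hS]

/-! ### Fatou's lemma along convergence in distribution -/

section Fatou

variable {ι S E : Type*}

/-- The `k`-Lipschitz lower envelope, truncated at `k`, of the values `G j x` put at the points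
`Y j x`, for `j ∈ s`. -/
def lowerEnvelope [PseudoEMetricSpace E] (Y : ι → S → E) (G : ι → S → ℝ≥0∞) (s : Set ι) (k : ℕ)
    (z : E) : ℝ≥0∞ :=
  min k (⨅ j ∈ s, ⨅ x, G j x + k * edist z (Y j x))

section LowerEnvelope

variable [PseudoEMetricSpace E] {Y : ι → S → E} {G : ι → S → ℝ≥0∞}

theorem continuous_lowerEnvelope (s : Set ι) (k : ℕ) : Continuous (lowerEnvelope Y G s k) := by
  refine continuous_of_le_add_edist k (ENNReal.natCast_ne_top k) fun z w => ?_
  unfold lowerEnvelope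
  rw [min_add]
  refine min_le_min le_self_add ?_
  simp only [ENNReal.iInf_add]
  refine iInf₂_mono fun j _ => iInf_mono fun x => ?_
  calc G j x + k * edist z (Y j x) ≤ G j x + k * (edist z w + edist w (Y j x)) := by
        gcongr; exact edist_triangle _ _ _
    _ = G j x + k * edist w (Y j x) + k * edist z w := by ring

theorem lowerEnvelope_le {s : Set ι} {k : ℕ} {j : ι} (hj : j ∈ s) (x : S) :
    lowerEnvelope Y G s k (Y j x) ≤ G j x :=
  (min_le_right _ _).trans ((iInf₂_le_of_le j hj (iInf_le _ x)).trans (by simp))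

theorem monotone_lowerEnvelope {s : ℕ → Set ι} (hs : Antitone s) (z : E) :
    Monotone fun k => lowerEnvelope Y G (s k) k z := by
  intro k l hkl
  refine min_le_min (by exact_mod_cast hkl) (le_iInf₂ fun j hj =>
    (iInf₂_le j (hs hkl hj)).trans (iInf_mono fun x => ?_))
  gcongr

theorem le_iSup_lowerEnvelope {L : Filter ι} {s : ℕ → Set ι} (hs : L.HasAntitoneBasis s) {z : E}
    {b : ℝ≥0∞} (h : ∀ c < b, ∀ᶠ p : ι × S in
      comap Prod.fst L ⊓ comap (fun p => Y p.1 p.2) (𝓝 z), c < G p.1 p.2) :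
    b ≤ ⨆ k, lowerEnvelope Y G (s k) k z := by
  refine le_of_forall_lt fun c hc => ?_
  obtain ⟨c', hcc', hc'⟩ := exists_between hc
  obtain ⟨⟨k, δ⟩, ⟨-, hδ⟩, hkδ⟩ :=
    (((hs.1.comap _).inf (Metric.nhds_basis_eball.comap _)).eventually_iff).1 (h c' hc')
  obtain ⟨l, hl⟩ := ENNReal.exists_nat_mul_gt (a := min 1 δ) (by simp [hδ.ne']) hc'.ne_top
  refine hcc'.trans_le (le_iSup_of_le (max k l) (le_min ?_ ?_))
  · calc c' ≤ l * min 1 δ := hl.le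
      _ ≤ (max k l : ℕ) * 1 := by gcongr <;> simp
      _ = _ := mul_one _
  · refine le_iInf₂ fun j hj => le_iInf fun x => ?_
    rcases lt_or_ge (edist z (Y j x)) δ with hlt | hge
    · exact (hkδ (x := (j, x)) ⟨hs.2 (le_max_left _ _) hj, by
        simpa [Metric.mem_eball, edist_comm] using hlt⟩).le.trans le_self_add
    · calc c' ≤ l * min 1 δ := hl.le
        _ ≤ (max k l : ℕ) * edist z (Y j x) := by
          gcongr
          · exact le_max_right _ _
          · exact (min_le_right _ _).trans hge
        _ ≤ _ := le_add_self

end LowerEnvelope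

theorem eventually_lt_lintegral_of_tendsto {Ω : Type*} [MeasurableSpace S] [MeasurableSpace Ω]
    [TopologicalSpace E] [TopologicalSpace.PseudoMetrizableSpace E] [MeasurableSpace E]
    [OpensMeasurableSpace E]
    {L : Filter ι} [L.IsCountablyGenerated] {Q : ι → Measure S} {P : Measure Ω} {Y : ι → S → E}
    {Z : Ω → E} (hZ : AEMeasurable Z P)
    (hYZ : ∀ F : E →ᵇ ℝ≥0,
      Tendsto (fun j => ∫⁻ x, F (Y j x) ∂Q j) L (𝓝 (∫⁻ ω, F (Z ω) ∂P)))
    {G : ι → S → ℝ≥0∞} {G' : Ω → ℝ≥0∞}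
    (hG : ∀ᵐ ω ∂P, ∀ b < G' ω, ∀ᶠ p : ι × S in
      comap Prod.fst L ⊓ comap (fun p => Y p.1 p.2) (𝓝 (Z ω)), b < G p.1 p.2)
    {b : ℝ≥0∞} (hb : b < ∫⁻ ω, G' ω ∂P) : ∀ᶠ j in L, b < ∫⁻ x, G j x ∂Q j := by
  let _ := TopologicalSpace.pseudoMetrizableSpacePseudoMetric E
  obtain ⟨s, hs⟩ := L.exists_antitone_basis
  have hsup : b < ⨆ k, ∫⁻ ω, lowerEnvelope Y G (s k) k (Z ω) ∂P := by
    rw [← lintegral_iSup' (f := fun k ω => lowerEnvelope Y G (s k) k (Z ω))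
      (fun k => (continuous_lowerEnvelope _ _).measurable.comp_aemeasurable hZ)
      (ae_of_all _ fun ω => monotone_lowerEnvelope hs.2 (Z ω))]
    exact hb.trans_le (lintegral_mono_ae (hG.mono fun ω => le_iSup_lowerEnvelope hs))
  obtain ⟨k, hk⟩ := lt_iSup_iff.1 hsup
  have hle : ∀ z, lowerEnvelope Y G (s k) k z ≤ (k : ℝ≥0) := fun z => min_le_left _ _
  have hne : ∀ z, lowerEnvelope Y G (s k) k z ≠ ∞ := fun z => ((hle z).trans_lt (by simp)).ne
  let F : E →ᵇ ℝ≥0 := .mkOfBound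
    ⟨fun z => (lowerEnvelope Y G (s k) k z).toNNReal, continuous_iff_continuousAt.2 fun z =>
      (ENNReal.tendsto_toNNReal (hne z)).comp (continuous_lowerEnvelope _ _).continuousAt⟩ k
    fun z w => by
      have hmem : ∀ z, ((lowerEnvelope Y G (s k) k z).toNNReal : ℝ) ∈ Icc (0 : ℝ) k := fun z =>
        ⟨NNReal.zero_le_coe, by
          exact_mod_cast (ENNReal.toNNReal_le_toNNReal (hne z) ENNReal.coe_ne_top).2 (hle z)⟩
      exact (Real.dist_le_of_mem_Icc (hmem z) (hmem w)).trans (sub_zero _).le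
  have hF : ∀ z, (F z : ℝ≥0∞) = lowerEnvelope Y G (s k) k z := fun z =>
    ENNReal.coe_toNNReal (hne z)
  have hlim := hYZ F
  simp only [hF] at hlim
  filter_upwards [hlim.eventually_const_lt hk, hs.1.mem_of_mem trivial] with j hj hjs
  exact hj.trans_le (lintegral_mono fun x => lowerEnvelope_le hjs x)

end Fatou

/-! ### Weak convergence of finite measures -/

theorem tendsto_finiteMeasure_of_isPiSystem {ι E : Type*} [Nonempty E] [MeasurableSpace E]
    [TopologicalSpace E] [SecondCountableTopology E] [OpensMeasurableSpace E] {S : Set (Set E)}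
    (hS : IsPiSystem S) (hmeas : ∀ s ∈ S, MeasurableSet s)
    (hnhds : ∀ u, IsOpen u → ∀ x ∈ u, ∃ s ∈ S, s ∈ 𝓝 x ∧ s ⊆ u) {L : Filter ι}
    [L.IsCountablyGenerated] {μs : ι → FiniteMeasure E} {μ : FiniteMeasure E}
    (h : ∀ s ∈ S, Tendsto (fun j => μs j s) L (𝓝 (μ s)))
    (hmass : Tendsto (fun j => (μs j).mass) L (𝓝 μ.mass)) : Tendsto μs L (𝓝 μ) := by
  rcases eq_or_ne μ 0 with rfl | hμ
  · exact FiniteMeasure.tendsto_zero_of_tendsto_zero_mass (by simpa using hmass)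
  have hμ' := μ.mass_nonzero_iff.2 hμ
  refine FiniteMeasure.tendsto_of_tendsto_normalize_testAgainstNN_of_tendsto_mass
    (hS.tendsto_probabilityMeasure_of_tendsto_of_mem hmeas hnhds fun s hs => ?_) hmass
  rw [μ.normalize_eq_of_nonzero hμ]
  refine ((hmass.inv₀ hμ').mul (h s hs)).congr' ?_
  filter_upwards [hmass.eventually_ne hμ'] with j hj
  rw [(μs j).normalize_eq_of_nonzero ((μs j).mass_nonzero_iff.1 hj)]

theorem tendsto_finiteMeasure_of_tendsto_Iic {ι : Type*} {L : Filter ι} [L.IsCountablyGenerated]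
    {μs : ι → FiniteMeasure ℝ} {μ : FiniteMeasure ℝ}
    (h : ∀ t, Tendsto (fun j => μs j (Iic t)) L (𝓝 (μ (Iic t))))
    (hmass : Tendsto (fun j => (μs j).mass) L (𝓝 μ.mass)) : Tendsto μs L (𝓝 μ) := by
  refine tendsto_finiteMeasure_of_isPiSystem (isPiSystem_Ioc id id) ?_ ?_ ?_ hmass
  · rintro _ ⟨a, b, -, rfl⟩
    exact measurableSet_Ioc
  · intro u hu x hx
    obtain ⟨ε, hε, hsub⟩ := Metric.isOpen_iff.1 hu x hx
    refine ⟨Ioc (x - ε / 2) (x + ε / 2), ⟨_, _, by simpa using by linarith, rfl⟩,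
      Ioc_mem_nhds (by linarith) (by linarith), fun y hy => hsub ?_⟩
    rw [Real.ball_eq_Ioo]
    exact ⟨by linarith [hy.1], by linarith [hy.2]⟩
  · rintro _ ⟨a, b, hab, rfl⟩
    have hdiff : Ioc a b = Iic b \ Iic a := by ext; simp [and_comm]
    have hIoc : ∀ ν : FiniteMeasure ℝ, ν (Ioc a b) = ν (Iic b) - ν (Iic a) := fun ν => by
      rw [← ENNReal.coe_inj, ENNReal.coe_sub, ν.ennreal_coeFn_eq_coeFn_toMeasure,
        ν.ennreal_coeFn_eq_coeFn_toMeasure, ν.ennreal_coeFn_eq_coeFn_toMeasure, hdiff,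
        measure_sdiff (Iic_subset_Iic.2 hab.le : Iic a ⊆ Iic b) measurableSet_Iic.nullMeasurableSet
          (measure_ne_top _ _)]
    simpa only [id, hIoc] using (h b).sub (h a)

theorem tendsto_lintegral_comp_of_tendsto_measure_le {S : Type*} [MeasurableSpace S] {J : Type*}
    {L : Filter J} [L.IsCountablyGenerated] {ν : J → Measure S} [∀ j, IsFiniteMeasure (ν j)]
    {φ : J → S → ℝ≥0} (hφ : ∀ j, Measurable (φ j)) {μ : Measure ℝ≥0} [IsFiniteMeasure μ]
    (h : ∀ t, Tendsto (fun j => ν j {i | φ j i ≤ t}) L (𝓝 (μ (Iic t))))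
    (huniv : Tendsto (fun j => ν j univ) L (𝓝 (μ univ))) (F : ℝ →ᵇ ℝ≥0) :
    Tendsto (fun j => ∫⁻ i, F (φ j i) ∂ν j) L (𝓝 (∫⁻ t, F t ∂μ)) := by
  have hφ' (j : J) : Measurable fun i => (φ j i : ℝ) := (hφ j).coe_nnreal_real
  let ν' (j : J) : FiniteMeasure ℝ := ⟨(ν j).map fun i => (φ j i : ℝ), inferInstance⟩
  let μ' : FiniteMeasure ℝ := ⟨μ.map ((↑) : ℝ≥0 → ℝ), inferInstance⟩
  have hν' (j : J) {s : Set ℝ} (hs : MeasurableSet s) :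
      (ν' j s : ℝ≥0∞) = ν j ((fun i => (φ j i : ℝ)) ⁻¹' s) := by
    rw [FiniteMeasure.ennreal_coeFn_eq_coeFn_toMeasure]
    exact Measure.map_apply (hφ' j) hs
  have hμ' {s : Set ℝ} (hs : MeasurableSet s) : (μ' s : ℝ≥0∞) = μ ((↑) ⁻¹' s) := by
    rw [FiniteMeasure.ennreal_coeFn_eq_coeFn_toMeasure]
    exact Measure.map_apply measurable_coe_nnreal_real hs
  have hlim : Tendsto ν' L (𝓝 μ') := by
    refine tendsto_finiteMeasure_of_tendsto_Iic (fun t => ?_) ?_ <;> rw [← ENNReal.tendsto_coe]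
    · simp only [hν' _ measurableSet_Iic, hμ' measurableSet_Iic]
      obtain ht | ht := lt_or_ge t 0
      · have hlt (r : ℝ≥0) : ¬ (r : ℝ) ≤ t := (ht.trans_le r.coe_nonneg).not_ge
        simp only [preimage, mem_Iic, hlt, ofPred_false, measure_empty]
        exact tendsto_const_nhds
      · lift t to ℝ≥0 using ht
        have hIic : ((↑) : ℝ≥0 → ℝ) ⁻¹' Iic (t : ℝ) = Iic t := by ext; simp
        rw [hIic]
        exact h t
    · simpa only [FiniteMeasure.mass, hν' _ .univ, hμ' .univ, preimage_univ] using huniv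
  have hF := FiniteMeasure.tendsto_iff_forall_lintegral_tendsto.1 hlim F
  have hFm : Measurable fun t => (F t : ℝ≥0∞) := F.continuous.measurable.coe_nnreal_ennreal
  simpa only [ν', μ', FiniteMeasure.toMeasure_mk, lintegral_map hFm (hφ' _),
    lintegral_map hFm measurable_coe_nnreal_real] using hF

/-! ### Uniform integrability from setwise convergence -/

theorem exists_eventually_lintegral_sub_natCast_le {X : Type*} [MeasurableSpace X] {μ : Measure X}
    {u : ℕ → X → ℝ≥0∞} {v : X → ℝ≥0∞} (hu : ∀ n, Measurable (u n)) (hv : ∫⁻ x, v x ∂μ ≠ ∞)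
    (h : ∀ C, MeasurableSet C →
      Tendsto (fun n => ∫⁻ x in C, u n x ∂μ) atTop (𝓝 (∫⁻ x in C, v x ∂μ)))
    {ε : ℝ≥0∞} (hε : ε ≠ 0) : ∃ K : ℕ, ∀ᶠ n in atTop, ∫⁻ x, (u n x - K) ∂μ ≤ ε := by
  by_contra! hcon
  obtain ⟨δ, hδ, hvδ⟩ := exists_pos_setLIntegral_lt_of_measure_lt hv hε
  obtain ⟨δ', hδ', hsum⟩ := ENNReal.exists_pos_sum_of_countable hδ.ne' ℕ
  obtain ⟨V, hvV, hV⟩ := exists_between hv.lt_top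
  choose K hK using fun k => ENNReal.exists_nat_mul_gt (a := δ' k)
    (by simpa using (hδ' k).ne') hV.ne
  have hbdd : ∀ᶠ n in atTop, ∫⁻ x, u n x ∂μ < V := by
    simpa using (h univ .univ).eventually_lt_const (u := V) (by simpa)
  obtain ⟨φ, hφ, hφε⟩ := extraction_forall_of_frequently fun k => (hcon (K k)).and_eventually hbdd
  set C : ℕ → Set X := fun k => {x | (K k : ℝ≥0∞) ≤ u (φ k) x}
  have hCm : ∀ k, MeasurableSet (C k) := fun k => measurableSet_le measurable_const (hu _)
  have hC : ∀ k, μ (C k) ≤ δ' k := fun k => by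
    by_contra! hlt
    have : (K k : ℝ≥0∞) * δ' k ≤ V := calc
      (K k : ℝ≥0∞) * δ' k ≤ K k * μ (C k) := by gcongr
      _ ≤ ∫⁻ x, u (φ k) x ∂μ := mul_meas_ge_le_lintegral (hu _) _
      _ ≤ V := (hφε k).2.le
    exact this.not_gt (hK k)
  have hD : ∫⁻ x in ⋃ k, C k, v x ∂μ < ε := hvδ _
    ((measure_iUnion_le C).trans_lt ((ENNReal.tsum_le_tsum hC).trans_lt hsum))
  obtain ⟨k, hk⟩ := (((h _ (.iUnion hCm)).comp hφ.tendsto_atTop).eventually_lt_const hD).exists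
  refine hk.not_ge ((hφε k).1.le.trans ?_)
  calc ∫⁻ x, (u (φ k) x - K k) ∂μ ≤ ∫⁻ x, (C k).indicator (u (φ k)) x ∂μ := by
        refine lintegral_mono fun x => ?_
        by_cases hx : x ∈ C k
        · simp [hx]
        · have hlt : u (φ k) x < K k := lt_of_not_ge fun hge => hx hge
          simp [tsub_eq_zero_of_le hlt.le]
    _ = ∫⁻ x in C k, u (φ k) x ∂μ := lintegral_indicator (hCm k) _
    _ ≤ _ := lintegral_mono_set (subset_iUnion C k)

/-! ### Joint convergence of occupation times -/

theorem tendstoInDistribution_of_tendsto_lintegral_edist {ι S Ω E : Type*} [MeasurableSpace S]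
    [MeasurableSpace Ω] [PseudoEMetricSpace E] [MeasurableSpace E] [OpensMeasurableSpace E]
    {L : Filter ι} [L.IsCountablyGenerated] {Q : Measure S} [IsProbabilityMeasure Q] {P : Measure Ω}
    [IsProbabilityMeasure P] {Y V : ι → S → E} {Z : Ω → E} (hY : ∀ j, AEMeasurable (Y j) Q)
    (hV : TendstoInDistribution V L Z (fun _ => Q) P)
    (hYV : Tendsto (fun j => ∫⁻ x, edist (Y j x) (V j x) ∂Q) L (𝓝 0)) :
    TendstoInDistribution Y L Z (fun _ => Q) P where
  forall_aemeasurable := hY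
  aemeasurable_limit := hV.aemeasurable_limit
  tendsto := by
    refine tendsto_iff_forall_lipschitz_integral_tendsto.2 fun F ⟨C, hC⟩ ⟨K, hK⟩ => ?_
    have hVF := tendsto_iff_forall_lipschitz_integral_tendsto.1 hV.tendsto F ⟨C, hC⟩ ⟨K, hK⟩
    have hFm {ν : Measure E} : AEStronglyMeasurable F ν :=
      hK.continuous.measurable.aestronglyMeasurable
    have hInt (U : S → E) (hU : AEMeasurable U Q) : Integrable (fun x => F (U x)) Q :=
      (integrable_map_measure hFm hU).1
        ((BoundedContinuousFunction.mkOfBound ⟨F, hK.continuous⟩ C hC).integrable _)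
    have hK0 : Tendsto (fun j => K * ∫⁻ x, edist (Y j x) (V j x) ∂Q) L (𝓝 0) := by
      simpa using ENNReal.Tendsto.const_mul hYV (.inr ENNReal.coe_ne_top)
    refine hVF.congr_uniformity (uniformity_basis_edist.tendsto_right_iff.2 fun ε hε => ?_)
    filter_upwards [hK0.eventually_lt_const hε] with j hj
    refine LE.le.trans_lt ?_ hj
    simp only [ProbabilityMeasure.coe_mk]
    rw [integral_map (hY j) hFm, integral_map (hV.forall_aemeasurable j) hFm, edist_comm,
      edist_eq_enorm_sub, ← integral_sub (hInt _ (hY j)) (hInt _ (hV.forall_aemeasurable j)),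
      ← lintegral_const_mul' _ _ ENNReal.coe_ne_top]
    exact (enorm_integral_le_lintegral_enorm _).trans
      (lintegral_mono fun x => (edist_eq_enorm_sub _ _).symm.trans_le (hK _ _))

section PiCountable

open scoped PiCountable

theorem tendstoInDistribution_pi_of_tendsto_lintegral_edist {κ S Ω : Type*} [Countable κ]
    [MeasurableSpace S] [MeasurableSpace Ω] {F : κ → Type*} [∀ p, PseudoEMetricSpace (F p)]
    [∀ p, SecondCountableTopology (F p)] [∀ p, MeasurableSpace (F p)]
    [∀ p, OpensMeasurableSpace (F p)] {Q : Measure S} [IsProbabilityMeasure Q] {P : Measure Ω}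
    [IsProbabilityMeasure P] {Y V : ℕ → S → ∀ p, F p} {Z : Ω → ∀ p, F p}
    (hY : ∀ n, Measurable (Y n)) (hVm : ∀ n, Measurable (V n))
    (hV : TendstoInDistribution V atTop Z (fun _ => Q) P)
    (hYV : ∀ p, Tendsto (fun n => ∫⁻ x, edist (Y n x p) (V n x p) ∂Q) atTop (𝓝 0)) :
    TendstoInDistribution Y atTop Z (fun _ => Q) P := by
  let _ := Encodable.ofCountable κ
  let _ : MeasurableSpace κ := ⊤
  refine tendstoInDistribution_of_tendsto_lintegral_edist (fun n => (hY n).aemeasurable) hV ?_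
  have hm (n : ℕ) (p : κ) : Measurable fun x => edist (Y n x p) (V n x p) :=
    (measurable_pi_iff.1 (hY n) p).edist (measurable_pi_iff.1 (hVm n) p)
  simp only [PiCountable.edist_eq_tsum]
  simp_rw [lintegral_tsum fun p => (measurable_const.min (hm _ p)).aemeasurable, ← lintegral_count]
  rw [← lintegral_zero (μ := Measure.count (α := κ))]
  refine tendsto_lintegral_of_dominated_convergence (fun p => 2⁻¹ ^ Encodable.encode p)
    (fun n => measurable_from_top) (fun n => ae_of_all _ fun p => ?_) ?_ (ae_of_all _ fun p => ?_)
  · exact (lintegral_mono fun x => min_le_left _ _).trans (by simp)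
  · rw [lintegral_count]
    refine ((ENNReal.tsum_comp_le_tsum_of_injective Encodable.encode_injective
      fun i => (2⁻¹ : ℝ≥0∞) ^ i).trans_lt ?_).ne
    simp [ENNReal.tsum_geometric]
  · exact tendsto_of_tendsto_of_tendsto_of_le_of_le tendsto_const_nhds (hYV p) (fun _ => zero_le)
      fun n => lintegral_mono fun x => min_le_right _ _

end PiCountable

theorem integrable_coe_unitInterval {S : Type*} [MeasurableSpace S] {Q : Measure S}
    [IsFiniteMeasure Q] {w : S → unitInterval} (hw : Measurable w) :
    Integrable (fun x => (w x : ℝ)) Q :=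
  .of_bound hw.subtype_val.aestronglyMeasurable 1 (ae_of_all _ fun x => by
    rw [Real.norm_of_nonneg (w x).2.1]; exact (w x).2.2)

theorem tendsto_lintegral_edist_of_tendsto_integral_mul {S : Type*} [MeasurableSpace S]
    {Q : Measure S} [IsProbabilityMeasure Q] {u v : ℕ → S → unitInterval} {l : ℝ}
    (hu : ∀ n, Measurable (u n)) (hv : ∀ n, Measurable (v n))
    (huu : Tendsto (fun n => ∫ x, ((u n x * u n x : unitInterval) : ℝ) ∂Q) atTop (𝓝 l))
    (huv : Tendsto (fun n => ∫ x, ((u n x * v n x : unitInterval) : ℝ) ∂Q) atTop (𝓝 l))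
    (hvv : Tendsto (fun n => ∫ x, ((v n x * v n x : unitInterval) : ℝ) ∂Q) atTop (𝓝 l)) :
    Tendsto (fun n => ∫⁻ x, edist (u n x) (v n x) ∂Q) atTop (𝓝 0) := by
  have hL2 (n : ℕ) : MemLp (fun x => dist (u n x) (v n x)) 2 Q :=
    .of_bound ((hu n).dist (hv n)).aestronglyMeasurable 1 (ae_of_all _ fun x => by
      rw [Real.norm_of_nonneg dist_nonneg]
      exact Real.dist_le_of_mem_Icc_01 (u n x).2 (v n x).2)
  have hsq (n : ℕ) : (∫ x, dist (u n x) (v n x) ∂Q) ^ 2 ≤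
      ∫ x, ((u n x * u n x : unitInterval) : ℝ) ∂Q -
        2 * ∫ x, ((u n x * v n x : unitInterval) : ℝ) ∂Q +
        ∫ x, ((v n x * v n x : unitInterval) : ℝ) ∂Q := by
    have hInt {w z : S → unitInterval} (hw : Measurable w) (hz : Measurable z) :
        Integrable (fun x => ((w x * z x : unitInterval) : ℝ)) Q :=
      integrable_coe_unitInterval (hw.mul hz)
    have huv := (hInt (hu n) (hv n)).const_mul 2
    refine (sub_nonneg.1 ((ProbabilityTheory.variance_nonneg _ Q).trans_eq
      (ProbabilityTheory.variance_eq_sub (hL2 n)))).trans_eq ?_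
    rw [← integral_const_mul, ← integral_sub' (hInt (hu n) (hu n)) huv,
      ← integral_add' ((hInt (hu n) (hu n)).sub huv) (hInt (hv n) (hv n))]
    refine integral_congr_ae (ae_of_all _ fun x => ?_)
    simp only [Pi.pow_apply, Subtype.dist_eq, Real.dist_eq, sq_abs, Pi.add_apply, Pi.sub_apply,
      Set.Icc.coe_mul]
    ring
  have hlim : Tendsto (fun n => ∫ x, dist (u n x) (v n x) ∂Q) atTop (𝓝 0) := by
    refine squeeze_zero (fun n => integral_nonneg fun x => dist_nonneg)
      (fun n => Real.le_sqrt_of_sq_le (hsq n)) ?_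
    simpa [two_mul] using ((huu.sub (huv.const_mul 2)).add hvv).sqrt
  rw [← ENNReal.ofReal_zero]
  refine (ENNReal.tendsto_ofReal hlim).congr fun n => ?_
  rw [ofReal_integral_eq_lintegral_ofReal ((hL2 n).integrable one_le_two)
    (ae_of_all _ fun x => dist_nonneg)]
  simp only [edist_dist]

section Psi

variable {X : Type*} {T : X → X} {a : ℕ → ℝ≥0}

theorem measurable_Psi [MeasurableSpace X] {f : X → ℝ≥0} (hT : Measurable T) (hf : Measurable f)
    (n : ℕ) : Measurable (Psi T a f n) :=
  measurable_of_eval fun _ =>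
    (Finset.measurable_fun_sum _ fun k _ => hf.comp (hT.iterate k)).div_const _

theorem Psi_const_mul (f : X → ℝ≥0) (c : ℝ≥0) (n : ℕ) (x : X) :
    Psi T a (fun y => c * f y) n x = (Psi T a f n x).scale c := by
  ext t
  simp [Psi, NonDec.scale, birkhoffSum, ← Finset.mul_sum, mul_div_assoc]

theorem lap_Psi_add (f f' : X → ℝ≥0) (n : ℕ) (x : X) :
    lap (Psi T a (fun y => f y + f' y) n x) = lap (Psi T a f n x) * lap (Psi T a f' n x) := by
  have h (q : ℝ≥0) : (Psi T a (fun y => f y + f' y) n x).primitive q =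
      (Psi T a f n x).primitive q + (Psi T a f' n x).primitive q := by
    rw [NonDec.primitive, NonDec.primitive, NonDec.primitive, ← intervalIntegral.integral_add
      (NonDec.intervalIntegrable_toNNReal _ _ _) (NonDec.intervalIntegrable_toNNReal _ _ _)]
    simp [Psi, birkhoffSum, Finset.sum_add_distrib, add_div]
  ext i
  simp [lap, h, Real.exp_add, mul_comm]

end Psi

theorem coe_indicator_one {X : Type*} (B : Set X) (x : X) :
    ((B.indicator (1 : X → ℝ≥0) x : ℝ≥0) : ℝ≥0∞) = B.indicator 1 x := by
  by_cases hx : x ∈ B <;> simp [hx]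

section IsL1Pos

variable {X : Type*} [MeasurableSpace X] {m : Measure X} {f f' : X → ℝ≥0}

theorem IsL1Pos.add (hf : IsL1Pos m f) (hf' : IsL1Pos m f') : IsL1Pos m fun x => f x + f' x := by
  refine ⟨hf.1.add hf'.1, ?_⟩
  simp only [ENNReal.coe_add]
  rw [lintegral_add_left hf.1.coe_nnreal_ennreal]
  exact ENNReal.add_lt_top.2 ⟨hf.2, hf'.2⟩

theorem IsL1Pos.const_mul (hf : IsL1Pos m f) (c : ℝ≥0) : IsL1Pos m fun x => c * f x := by
  refine ⟨hf.1.const_mul c, ?_⟩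
  simp only [ENNReal.coe_mul]
  rw [lintegral_const_mul _ hf.1.coe_nnreal_ennreal]
  exact ENNReal.mul_lt_top ENNReal.coe_lt_top hf.2

theorem IsL1Pos.integ_add (hf : IsL1Pos m f) (hf' : IsL1Pos m f') :
    integ m (fun x => f x + f' x) = integ m f + integ m f' := by
  simp only [integ, ENNReal.coe_add]
  rw [lintegral_add_left hf.1.coe_nnreal_ennreal, ENNReal.toNNReal_add hf.2.ne hf'.2.ne]

theorem IsL1Pos.integ_const_mul (hf : IsL1Pos m f) (c : ℝ≥0) :
    integ m (fun x => c * f x) = c * integ m f := by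
  simp only [integ, ENNReal.coe_mul]
  rw [lintegral_const_mul _ hf.1.coe_nnreal_ennreal, ENNReal.toNNReal_mul, ENNReal.toNNReal_coe]

theorem exists_isL1Pos_integ_eq_one (m : Measure X) [SigmaFinite m] [NeZero m] :
    ∃ f : X → ℝ≥0, IsL1Pos m f ∧ integ m f = 1 := by
  obtain ⟨g, hg0, hg, hg1⟩ := exists_pos_lintegral_lt_of_sigmaFinite m one_ne_zero
  have hgL : IsL1Pos m g := ⟨hg, hg1.trans ENNReal.one_lt_top⟩
  have hInt : integ m g ≠ 0 := by
    refine ENNReal.toNNReal_ne_zero.2 ⟨fun h => NeZero.ne m ?_, hgL.2.ne⟩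
    rw [lintegral_eq_zero_iff hg.coe_nnreal_ennreal] at h
    exact ae_eq_bot.1 (eventually_false_iff_eq_bot.1
      (h.mono fun x hx => (hg0 x).ne' (ENNReal.coe_eq_zero.1 hx)))
  exact ⟨_, hgL.const_mul (integ m g)⁻¹, by rw [hgL.integ_const_mul, inv_mul_cancel₀ hInt]⟩

theorem isL1Pos_indicator {B : Set X} (hB : MeasurableSet B) (h : m B < ∞) :
    IsL1Pos m (B.indicator 1) := by
  refine ⟨measurable_one.indicator hB, ?_⟩
  simpa only [coe_indicator_one, lintegral_indicator_one hB] using h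

theorem integ_indicator {B : Set X} (hB : MeasurableSet B) :
    integ m (B.indicator 1) = (m B).toNNReal := by
  simp only [integ, coe_indicator_one, lintegral_indicator_one hB]

end IsL1Pos

/-- `M` is the distributional limit of the normalized Birkhoff sums: `Psi T a f n` converges to
`m(f) M` in the sense of `StrongDistConv`, for all `f ∈ L¹(m)₊`. -/
def HasStrongLimit {X Ω : Type*} [MeasurableSpace X] [MeasurableSpace Ω] (m : Measure X)
    (T : X → X) (a : ℕ → ℝ≥0) (P : Measure Ω) (M : Ω → DInf) : Prop :=
  ∀ f : X → ℝ≥0, IsL1Pos m f → StrongDistConv m (Psi T a f) P fun ω => (M ω).scale (integ m f)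

section Joint

variable {X Ω : Type*} [MeasurableSpace X] [MeasurableSpace Ω] {m Q : Measure X}
  [IsProbabilityMeasure Q] {P : Measure Ω} {T : X → X} {a : ℕ → ℝ≥0} {M : Ω → DInf}

theorem tendsto_integral_lap_mul_lap (hQ : Q ≪ m)
    (hconv : HasStrongLimit m T a P M)
    {f f' : X → ℝ≥0} (hf : IsL1Pos m f) (hf' : IsL1Pos m f') (i : ℕ) :
    Tendsto (fun n => ∫ x, ((lap (Psi T a f n x) i * lap (Psi T a f' n x) i : unitInterval) : ℝ) ∂Q)
      atTop (𝓝 (∫ ω, lap ((M ω).scale (integ m f + integ m f')) i ∂P)) := by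
  have h := hconv _ (hf.add hf') Q inferInstance hQ (.ofNormedAddCommGroup (fun ξ => lap ξ i)
    (continuous_subtype_val.comp ((continuous_apply i).comp continuous_lap)) 1 fun ξ => by
      rw [Real.norm_of_nonneg (lap ξ i).2.1]; exact (lap ξ i).2.2)
  simpa only [BoundedContinuousFunction.coe_ofNormedAddCommGroup, lap_Psi_add,
    hf.integ_add hf', Pi.mul_apply] using h

theorem tendsto_lintegral_edist_lap (hT : Measurable T) (hQ : Q ≪ m)
    (hconv : HasStrongLimit m T a P M)
    {f f' : X → ℝ≥0} (hf : IsL1Pos m f) (hf' : IsL1Pos m f') (h : integ m f = integ m f') (i : ℕ) :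
    Tendsto (fun n => ∫⁻ x, edist (lap (Psi T a f n x) i) (lap (Psi T a f' n x) i) ∂Q) atTop
      (𝓝 0) := by
  have hm {g : X → ℝ≥0} (hg : IsL1Pos m g) (n : ℕ) : Measurable fun x => lap (Psi T a g n x) i :=
    (measurable_pi_iff.1 measurable_lap i).comp (measurable_Psi hT hg.1 n)
  have hlim {g g' : X → ℝ≥0} (hg : IsL1Pos m g) (hg' : IsL1Pos m g') :=
    tendsto_integral_lap_mul_lap hQ hconv hg hg' i
  exact tendsto_lintegral_edist_of_tendsto_integral_mul (hm hf) (hm hf') (hlim hf hf)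
    (by simpa only [h] using hlim hf hf') (by simpa only [h] using hlim hf' hf')

theorem continuous_lap_scale (c : ℝ≥0) : Continuous fun ξ : DInf => lap (ξ.scale c) :=
  continuous_pi fun i => by
    simp only [lap, NonDec.primitive_scale]
    exact ((continuous_primitive_apply _).const_mul _).neg.rexp.subtype_mk _

theorem NonDec.scale_one {I : Type*} [LinearOrder I] [TopologicalSpace I] (ξ : NonDec I) :
    ξ.scale 1 = ξ := by
  ext t
  simp [scale]

theorem measurable_scale {I : Type*} [LinearOrder I] [TopologicalSpace I] (c : ℝ≥0) :
    Measurable fun ξ : NonDec I => ξ.scale c :=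
  measurable_of_eval fun t => (measurable_eval t).const_mul c

theorem measurable_lap_pi {κ β : Type*} [MeasurableSpace β] {Φ : κ → β → DInf}
    (hΦ : ∀ j, Measurable (Φ j)) : Measurable fun x (p : κ × ℕ) => lap (Φ p.1 x) p.2 :=
  measurable_pi_iff.2 fun p => (measurable_pi_iff.1 measurable_lap p.2).comp (hΦ p.1)

/-- Joint convergence is automatic: by `tendsto_lintegral_edist_lap` the occupation times of all the
`f j` are asymptotically multiples of those of a single function. -/
theorem tendstoInDistribution_lap_Psi {κ : Type*} [Countable κ] [IsProbabilityMeasure P]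
    [SigmaFinite m] (hT : Measurable T) (hM : Measurable M) (hQ : Q ≪ m)
    (hconv : HasStrongLimit m T a P M) {f : κ → X → ℝ≥0} (hf : ∀ j, IsL1Pos m (f j)) :
    TendstoInDistribution (fun n x (p : κ × ℕ) => lap (Psi T a (f p.1) n x) p.2) atTop
      (fun ω p => lap ((M ω).scale (integ m (f p.1))) p.2) (fun _ => Q) P := by
  have : NeZero m := ⟨fun h => IsProbabilityMeasure.ne_zero Q (by simpa [h] using hQ)⟩
  obtain ⟨f₀, hf₀, hf₀1⟩ := exists_isL1Pos_integ_eq_one m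
  have hY (n : ℕ) := measurable_lap_pi fun j => measurable_Psi (a := a) hT (hf j).1 n
  have hV (n : ℕ) := measurable_lap_pi (Φ := fun j x => (Psi T a f₀ n x).scale (integ m (f j)))
    fun j => (measurable_scale _).comp (measurable_Psi hT hf₀.1 n)
  have hZ := measurable_lap_pi (Φ := fun j ω => (M ω).scale (integ m (f j)))
    fun j => (measurable_scale _).comp hM
  refine tendstoInDistribution_pi_of_tendsto_lintegral_edist hY hV ?_ fun p => ?_
  · refine ⟨fun n => (hV n).aemeasurable, hZ.aemeasurable,
      ProbabilityMeasure.tendsto_iff_forall_integral_tendsto.2 fun F => ?_⟩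
    simp only [ProbabilityMeasure.coe_mk]
    rw [integral_map hZ.aemeasurable F.continuous.aestronglyMeasurable]
    simp_rw [fun n => integral_map (μ := Q) (hV n).aemeasurable
      F.continuous.aestronglyMeasurable]
    have h := hconv f₀ hf₀ Q inferInstance hQ (F.compContinuous ⟨fun ξ p =>
      lap (ξ.scale (integ m (f p.1))) p.2, continuous_pi fun p =>
        (continuous_apply p.2).comp (continuous_lap_scale _)⟩)
    simpa [hf₀1, NonDec.scale_one] using h
  · simp only [← Psi_const_mul]
    exact tendsto_lintegral_edist_lap hT hQ hconv (hf p.1) (hf₀.const_mul _)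
      (by rw [hf₀.integ_const_mul, hf₀1, mul_one]) p.2

end Joint

/-! ### The measure of a non-decreasing function, and dilations -/

theorem NonDec.measure_Icc_zero (ξ : DInf) (t : ℝ≥0) : ξ.measure (Icc 0 t) = ξ t := by
  have hbot : 𝓝[<] (0 : ℝ≥0) = ⊥ := by simp
  have h0 : (ξ 0 : ℝ≥0∞) ≤ ξ t := by exact_mod_cast ξ.mono zero_le
  rw [NonDec.measure, Measure.add_apply, Measure.smul_apply, StieltjesFunction.measure_Icc,
    leftLim_eq_of_eq_bot _ hbot, Measure.dirac_apply' _ measurableSet_Icc]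
  simp [ENNReal.ofReal_sub, add_tsub_cancel_of_le h0]

instance (ξ : DInf) : IsFiniteMeasure (ξ.measure.restrict (Icc 0 1)) :=
  ⟨by rw [Measure.restrict_apply_univ, ξ.measure_Icc_zero]; exact ENNReal.coe_lt_top⟩

theorem measurable_toOne : Measurable NonDec.toOne :=
  measurable_of_eval fun t => measurable_eval (t : ℝ≥0)

theorem measurable_dilate_toOne (γ : ℝ) :
    Measurable fun p : DInf × ℝ≥0 => (p.1.dilate γ p.2).toOne :=
  measurable_of_eval fun s => (measurable_eval_uncurry.comp
    (measurable_fst.prodMk (measurable_snd.mul_const (s : ℝ≥0)))).div (measurable_snd.pow_const γ)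

theorem continuous_scale {I : Type*} [LinearOrder I] [TopologicalSpace I] {ξ : NonDec I}
    (hξ : Continuous ξ.toFun) (c : ℝ≥0) : Continuous (ξ.scale c).toFun :=
  hξ.const_mul c

theorem continuous_dilate_toOne {M : DInf} (hM : Continuous M.toFun) (γ : ℝ) (t : ℝ≥0) :
    Continuous (M.dilate γ t).toOne.toFun :=
  (hM.comp ((continuous_const_mul t).comp continuous_subtype_val)).div_const (t ^ γ)

/-! ### Regular variation -/

theorem IsRegularlyVarying.tendsto_div_floor {γ : ℝ} {a : ℕ → ℝ≥0} (ha : IsRegularlyVarying γ a)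
    {S : ℕ → ℝ} {l : ℝ} (hl : l ≠ 0) (hSa : Tendsto (fun n => S n / a n) atTop (𝓝 l)) {c : ℝ}
    (hc : 0 < c) : Tendsto (fun n : ℕ => S ⌊c * n⌋₊ / S n) atTop (𝓝 (c ^ γ)) := by
  have hfl : Tendsto (fun n : ℕ => ⌊c * n⌋₊) atTop atTop :=
    tendsto_nat_floor_atTop.comp (tendsto_natCast_atTop_atTop.const_mul_atTop hc)
  have h := ((hSa.comp hfl).mul (ha c hc)).div hSa hl
  rw [mul_div_cancel_left₀ _ hl] at h
  refine h.congr' ?_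
  filter_upwards [hSa.eventually_ne hl, hfl.eventually (hSa.eventually_ne hl)] with n hn hn'
  rw [div_ne_zero_iff] at hn hn'
  simp only [Function.comp_apply, Pi.div_apply]
  field_simp [hn.1, hn.2, hn'.1, hn'.2]

/-- Locally uniform regular variation: `a k / a n → t ^ γ` as `n → ∞` and `k / n → t ≠ 0`. -/
def IsLocallyUniformlyRegularlyVarying (γ : ℝ) (a : ℕ → ℝ≥0) : Prop :=
  ∀ t : ℝ≥0, t ≠ 0 → Tendsto (fun q : ℕ × ℕ => a q.2 / a q.1)
    (comap Prod.fst atTop ⊓ comap (fun q => (q.2 : ℝ≥0) / q.1) (𝓝 t)) (𝓝 (t ^ γ))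

theorem IsRegularlyVarying.isLocallyUniformlyRegularlyVarying {γ : ℝ} {a : ℕ → ℝ≥0}
    (ha : IsRegularlyVarying γ a) {S : ℕ → ℝ} (hS : Monotone S) (hS0 : ∀ n, 0 ≤ S n) {l : ℝ}
    (hl : l ≠ 0) (hSa : Tendsto (fun n => S n / a n) atTop (𝓝 l)) :
    IsLocallyUniformlyRegularlyVarying γ a := by
  intro t ht
  set L := comap Prod.fst atTop ⊓ comap (fun q : ℕ × ℕ => (q.2 : ℝ≥0) / q.1) (𝓝 t)
  have ht' : (0 : ℝ) < t := NNReal.coe_pos.2 (pos_iff_ne_zero.2 ht)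
  have hn : Tendsto Prod.fst L atTop := tendsto_comap.mono_left inf_le_left
  have hkn : Tendsto (fun q : ℕ × ℕ => (q.2 : ℝ) / q.1) L (𝓝 t) :=
    (NNReal.tendsto_coe.2 (tendsto_comap.mono_left inf_le_right)).congr fun q => by simp
  have hn0 : ∀ᶠ q in L, (q.1 : ℝ) ≠ 0 :=
    (hn.eventually_ne_atTop 0).mono fun q hq => Nat.cast_ne_zero.2 hq
  have hk : Tendsto Prod.snd L atTop := by
    refine tendsto_natCast_atTop_iff.1 ((hkn.pos_mul_atTop ht'
      (tendsto_natCast_atTop_atTop.comp hn)).congr' ?_)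
    filter_upwards [hn0] with q hq using div_mul_cancel₀ _ hq
  have hSk : Tendsto (fun q : ℕ × ℕ => S q.2 / S q.1) L (𝓝 ((t : ℝ) ^ γ)) := by
    refine (tendsto_apply_of_monotone (F := fun (q : ℕ × ℕ) (s : ℝ) => S ⌊s * q.1⌋₊ / S q.1)
      (f := fun s => s ^ γ) (fun q s s' h => ?_) ?_
      (Real.continuousAt_rpow_const _ _ (.inl ht'.ne')) hkn).congr' ?_
    · exact div_le_div_of_nonneg_right (hS (Nat.floor_mono (by gcongr))) (hS0 _)
    · filter_upwards [eventually_gt_nhds ht'] with s hs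
        using (ha.tendsto_div_floor hl hSa hs).comp hn
    · filter_upwards [hn0] with q hq
      rw [div_mul_cancel₀ _ hq, Nat.floor_natCast]
  have h := (hSk.mul (hSa.comp hn)).div (hSa.comp hk) hl
  rw [mul_div_cancel_right₀ _ hl] at h
  rw [← NNReal.tendsto_coe]
  refine h.congr' ?_
  filter_upwards [hn.eventually (hSa.eventually_ne hl), hk.eventually (hSa.eventually_ne hl)]
    with q hq hq'
  rw [div_ne_zero_iff] at hq hq'
  simp only [Function.comp_apply, Pi.div_apply, NNReal.coe_div]
  field_simp [hq.1, hq.2, hq'.1, hq'.2]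

/-! ### Visits along a converging sequence of occupation times -/

/-- The measure on `ℕ` with mass `b (T^i x) / a n` at each `i < n`: the increments of
`Psi T a b n x` over `[0, 1]`, labelled by time. -/
def visitMeasure {X : Type*} (T : X → X) (a : ℕ → ℝ≥0) (b : X → ℝ≥0) (n : ℕ) (x : X) : Measure ℕ :=
  ∑ i ∈ Finset.range n, (b (T^[i] x) / a n) • Measure.dirac i

section Visits

variable {X J : Type*} {T : X → X} {a : ℕ → ℝ≥0} {f b : X → ℝ≥0} {γ : ℝ} {L : Filter J}
  {n k : J → ℕ} {x : J → X} {M : DInf} {c c' : ℝ≥0}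

instance (n : ℕ) (x : X) : IsFiniteMeasure (visitMeasure T a b n x) := by
  unfold visitMeasure; infer_instance

theorem lintegral_visitMeasure (n : ℕ) (x : X) (φ : ℕ → ℝ≥0∞) :
    ∫⁻ i, φ i ∂visitMeasure T a b n x =
      ∑ i ∈ Finset.range n, (b (T^[i] x) / a n : ℝ≥0) * φ i := by
  simp only [visitMeasure, lintegral_finsetSum_measure, lintegral_smul_measure, lintegral_dirac,
    ENNReal.smul_def, smul_eq_mul]

theorem visitMeasure_setOf_div_le {n : ℕ} (hn : n ≠ 0) (x : X) (t : ℝ≥0) :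
    visitMeasure T a b n x {i | ((i + 1 : ℕ) : ℝ≥0) / n ≤ t} = Psi T a b n x (min t 1) := by
  have hn' : (0 : ℝ≥0) < n := by exact_mod_cast Nat.pos_of_ne_zero hn
  have hfil : (Finset.range n).filter (fun i => ((i + 1 : ℕ) : ℝ≥0) / n ≤ t) =
      Finset.range ⌊(n : ℝ≥0) * min t 1⌋₊ := by
    ext i
    rw [Finset.mem_filter, Finset.mem_range, Finset.mem_range, Nat.lt_iff_add_one_le (m := i),
      Nat.lt_iff_add_one_le (m := i), Nat.le_floor_iff zero_le, div_le_iff₀' hn', mul_min, mul_one,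
      le_min_iff, Nat.cast_le, and_comm]
  rw [← lintegral_indicator_one (.of_discrete), lintegral_visitMeasure]
  simp only [indicator_apply, mem_ofPred_eq, Pi.one_apply, mul_ite, mul_one, mul_zero]
  rw [← Finset.sum_filter, hfil, ← ENNReal.ofNNReal_finsetSum, ← Finset.sum_div]
  rfl

theorem visitMeasure_univ (n : ℕ) (x : X) : visitMeasure T a b n x univ = Psi T a b n x 1 := by
  rw [← lintegral_one, lintegral_visitMeasure]
  simp [Psi, birkhoffSum, ← Finset.sum_div, ← ENNReal.ofNNReal_finsetSum]

theorem Psi_eq_div {k n : ℕ} (hn : n ≠ 0) (han : a n ≠ 0) (x : X) (s : ℝ≥0) :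
    Psi T a f k x s = Psi T a f n x ((k : ℝ≥0) / n * s) / (a k / a n) := by
  have hn' : (n : ℝ≥0) ≠ 0 := by exact_mod_cast hn
  simp only [Psi]
  rw [← mul_assoc, mul_div_cancel₀ _ hn', div_div_div_cancel_right₀ han]

theorem tendsto_Psi_toOne (hM : Continuous M.toFun) (hn : Tendsto n L atTop)
    (han : ∀ᶠ j in L, a (n j) ≠ 0)
    (hf : ∀ s, Tendsto (fun j => Psi T a f (n j) (x j) s) L (𝓝 (c * M s))) {t : ℝ≥0} (ht : t ≠ 0)
    (hk : Tendsto (fun j => (k j : ℝ≥0) / n j) L (𝓝 t))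
    (hka : Tendsto (fun j => a (k j) / a (n j)) L (𝓝 (t ^ γ))) :
    Tendsto (fun j => (Psi T a f (k j) (x j)).toOne) L (𝓝 ((M.dilate γ t).toOne.scale c)) := by
  refine tendsto_nhds_of_forall_tendsto_apply (continuous_scale (continuous_dilate_toOne hM γ t) c)
    fun s => ?_
  have h := (tendsto_apply_of_monotone (fun j => (Psi T a f (n j) (x j)).mono) (.of_forall hf)
    (continuous_scale hM c).continuousAt (hk.mul_const (s : ℝ≥0))).div hka
    (NNReal.rpow_pos (pos_iff_ne_zero.2 ht)).ne'
  rw [mul_div_assoc] at h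
  refine h.congr' ?_
  filter_upwards [hn.eventually_ne_atTop 0, han] with j hj haj using (Psi_eq_div hj haj _ _).symm

theorem tendsto_lintegral_visitMeasure [L.IsCountablyGenerated] (hn : Tendsto n L atTop)
    (hb : ∀ s, Tendsto (fun j => Psi T a b (n j) (x j) s) L (𝓝 (c' * M s))) (F : ℝ →ᵇ ℝ≥0) :
    Tendsto (fun j => ∫⁻ i, F (((i + 1 : ℕ) : ℝ≥0) / n j : ℝ≥0) ∂visitMeasure T a b (n j) (x j)) L
      (𝓝 (∫⁻ t in Icc (0 : ℝ≥0) 1, F t ∂(c' • M.measure))) := by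
  rw [Measure.restrict_smul]
  refine tendsto_lintegral_comp_of_tendsto_measure_le (fun j => .of_discrete) (fun t => ?_) ?_ F
  · rw [Measure.smul_apply, Measure.restrict_apply measurableSet_Iic, ← Icc_bot, Icc_inter_Icc,
      bot_eq_zero, max_self, M.measure_Icc_zero, ENNReal.smul_def, smul_eq_mul, ← ENNReal.coe_mul]
    refine (ENNReal.tendsto_coe.2 (hb (min t 1))).congr' ?_
    filter_upwards [hn.eventually_ne_atTop 0] with j hj
      using (visitMeasure_setOf_div_le hj _ _).symm
  · rw [Measure.smul_apply, Measure.restrict_apply_univ, M.measure_Icc_zero, ENNReal.smul_def,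
      smul_eq_mul, ← ENNReal.coe_mul]
    simpa only [visitMeasure_univ] using ENNReal.tendsto_coe.2 (hb 1)

theorem tendsto_Psi_succ_toOne (hreg : IsLocallyUniformlyRegularlyVarying γ a)
    (han : ∀ᶠ n in atTop, a n ≠ 0) (hM : Continuous M.toFun) (hn : Tendsto n L atTop)
    (hf : ∀ s, Tendsto (fun j => Psi T a f (n j) (x j) s) L (𝓝 (c * M s))) {t : ℝ≥0} (ht : t ≠ 0) :
    Tendsto (fun p : J × ℕ => (Psi T a f (p.2 + 1) (x p.1)).toOne)
      (comap Prod.fst L ⊓ comap (fun p => (((p.2 + 1 : ℕ) : ℝ≥0) / n p.1 : ℝ≥0)) (𝓝 t))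
      (𝓝 ((M.dilate γ t).toOne.scale c)) := by
  set L' := comap Prod.fst L ⊓ comap (fun p : J × ℕ => ((p.2 + 1 : ℕ) : ℝ≥0) / n p.1) (𝓝 t)
  have hfst : Tendsto Prod.fst L' L := tendsto_comap.mono_left inf_le_left
  have hk : Tendsto (fun p : J × ℕ => ((p.2 + 1 : ℕ) : ℝ≥0) / n p.1) L' (𝓝 t) :=
    tendsto_comap.mono_left inf_le_right
  have hq : Tendsto (fun p : J × ℕ => (n p.1, p.2 + 1)) L' (comap Prod.fst atTop ⊓
      comap (fun q : ℕ × ℕ => (q.2 : ℝ≥0) / q.1) (𝓝 t)) :=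
    tendsto_inf.2 ⟨tendsto_comap_iff.2 (hn.comp hfst), tendsto_comap_iff.2 hk⟩
  exact tendsto_Psi_toOne (n := fun p : J × ℕ => n p.1) (x := fun p => x p.1) hM (hn.comp hfst)
    (hfst.eventually (hn.eventually han)) (fun s => (hf s).comp hfst) ht hk ((hreg t ht).comp hq)

theorem eventually_lt_lintegral_visitMeasure [L.IsCountablyGenerated]
    (hreg : IsLocallyUniformlyRegularlyVarying γ a) (han : ∀ᶠ n in atTop, a n ≠ 0)
    (hM : Continuous M.toFun) (hM0 : M 0 = 0) (hn : Tendsto n L atTop)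
    (hf : ∀ s, Tendsto (fun j => Psi T a f (n j) (x j) s) L (𝓝 (c * M s)))
    (hb : ∀ s, Tendsto (fun j => Psi T a b (n j) (x j) s) L (𝓝 (c' * M s)))
    {h : DOne → ℝ≥0∞} (hh : ∀ ξ : DOne, Continuous ξ.toFun → LowerSemicontinuousAt h ξ) {r : ℝ≥0∞}
    (hr : r < ∫⁻ t in Icc (0 : ℝ≥0) 1, h ((M.dilate γ t).toOne.scale c) ∂(c' • M.measure)) :
    ∀ᶠ j in L, r < ∫⁻ i, h (Psi T a f (i + 1) (x j)).toOne ∂visitMeasure T a b (n j) (x j) := by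
  refine eventually_lt_lintegral_of_tendsto
    (Y := fun j (i : ℕ) => ((((i + 1 : ℕ) : ℝ≥0) / n j : ℝ≥0) : ℝ))
    (G := fun j i => h (Psi T a f (i + 1) (x j)).toOne)
    measurable_coe_nnreal_real.aemeasurable (tendsto_lintegral_visitMeasure hn hb) ?_ hr
  have hpos : ∀ᵐ t ∂(c' • M.measure).restrict (Icc (0 : ℝ≥0) 1), t ≠ 0 := by
    have h0 : M.measure {0} = 0 := by simpa [hM0] using M.measure_Icc_zero 0
    refine ae_restrict_of_ae (measure_mono_null (t := {0}) (by simp) ?_)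
    simp [h0]
  filter_upwards [hpos] with t ht s hs
  have hcomap : comap (fun p : J × ℕ => ((((p.2 + 1 : ℕ) : ℝ≥0) / n p.1 : ℝ≥0) : ℝ)) (𝓝 (t : ℝ)) =
      comap (fun p : J × ℕ => ((p.2 + 1 : ℕ) : ℝ≥0) / n p.1) (𝓝 t) := by
    rw [NNReal.isEmbedding_coe.nhds_eq_comap, comap_comap]
    rfl
  rw [hcomap]
  exact (tendsto_Psi_succ_toOne hreg han hM hn hf ht).eventually
    (hh _ (continuous_scale (continuous_dilate_toOne hM γ t) c) s hs)

end Visits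

/-! ### Lower bounds along the distributional limit -/

section Fatou

variable {X Ω : Type*} [MeasurableSpace X] [MeasurableSpace Ω] {m : Measure X} [SigmaFinite m]
  {P : Measure Ω} [IsProbabilityMeasure P] {T : X → X} {a : ℕ → ℝ≥0} {M : Ω → DInf}

theorem tendsto_lintegral_lap_Psi {Q : Measure X} [IsProbabilityMeasure Q] {κ : Type*} [Countable κ]
    (hT : Measurable T) (hM : Measurable M) (hQ : Q ≪ m) (hconv : HasStrongLimit m T a P M)
    {f : κ → X → ℝ≥0} (hf : ∀ j, IsL1Pos m (f j)) (F : (κ × ℕ → unitInterval) →ᵇ ℝ≥0) :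
    Tendsto (fun n => ∫⁻ x, F (fun p => lap (Psi T a (f p.1) n x) p.2) ∂Q) atTop
      (𝓝 (∫⁻ ω, F (fun p => lap ((M ω).scale (integ m (f p.1))) p.2) ∂P)) := by
  have h := tendstoInDistribution_lap_Psi hT hM hQ hconv hf
  have hF := ProbabilityMeasure.tendsto_iff_forall_lintegral_tendsto.1 h.tendsto F
  have hFm : Measurable fun y => (F y : ℝ≥0∞) := F.continuous.measurable.coe_nnreal_ennreal
  simpa only [ProbabilityMeasure.coe_mk, lintegral_map' hFm.aemeasurable
    (h.forall_aemeasurable _), lintegral_map' hFm.aemeasurable h.aemeasurable_limit] using hF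

theorem eventually_lt_lintegral_of_hasStrongLimit {Q : Measure X} [IsProbabilityMeasure Q]
    {κ : Type*} [Countable κ] (hT : Measurable T) (hM : Measurable M)
    (hMcont : ∀ᵐ ω ∂P, Continuous (M ω).toFun) (hM0 : ∀ᵐ ω ∂P, M ω 0 = 0) (hQ : Q ≪ m)
    (hconv : HasStrongLimit m T a P M) {f : κ → X → ℝ≥0} (hf : ∀ j, IsL1Pos m (f j))
    {G : ℕ → X → ℝ≥0∞} {G' : Ω → ℝ≥0∞}
    (hG : ∀ᵐ ω ∂P, ∀ L : Filter (ℕ × X), L.IsCountablyGenerated → Tendsto Prod.fst L atTop →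
      (∀ j t, Tendsto (fun p => Psi T a (f j) p.1 p.2 t) L (𝓝 (integ m (f j) * M ω t))) →
      ∀ r < G' ω, ∀ᶠ p in L, r < G p.1 p.2)
    {r : ℝ≥0∞} (hr : r < ∫⁻ ω, G' ω ∂P) : ∀ᶠ n in atTop, r < ∫⁻ x, G n x ∂Q := by
  have hZ := measurable_lap_pi (Φ := fun j ω => (M ω).scale (integ m (f j)))
    fun j => (measurable_scale _).comp hM
  refine eventually_lt_lintegral_of_tendsto hZ.aemeasurable
    (tendsto_lintegral_lap_Psi hT hM hQ hconv hf) ?_ hr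
  filter_upwards [hMcont, hM0, hG] with ω hω hω0 hGω
  set L : Filter (ℕ × X) := comap Prod.fst atTop ⊓ comap
    (fun p (q : κ × ℕ) => lap (Psi T a (f q.1) p.1 p.2) q.2)
    (𝓝 fun q => lap ((M ω).scale (integ m (f q.1))) q.2)
  have hlap : Tendsto (fun p (q : κ × ℕ) => lap (Psi T a (f q.1) p.1 p.2) q.2) L
      (𝓝 fun q => lap ((M ω).scale (integ m (f q.1))) q.2) := tendsto_comap.mono_left inf_le_right
  refine hGω L inferInstance (tendsto_comap.mono_left inf_le_left) fun j t => ?_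
  refine tendsto_apply_of_tendsto_lap (continuous_scale hω _) (by simp [NonDec.scale, hω0]) ?_ t
  exact tendsto_pi_nhds.2 fun i => tendsto_pi_nhds.1 hlap (j, i)

theorem eventually_lt_setLIntegral_of_hasStrongLimit {A : Set X} (hA : m A ≠ ∞)
    {κ : Type*} [Countable κ] (hT : Measurable T) (hM : Measurable M)
    (hMcont : ∀ᵐ ω ∂P, Continuous (M ω).toFun) (hM0 : ∀ᵐ ω ∂P, M ω 0 = 0)
    (hconv : HasStrongLimit m T a P M) {f : κ → X → ℝ≥0} (hf : ∀ j, IsL1Pos m (f j))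
    {G : ℕ → X → ℝ≥0∞} {G' : Ω → ℝ≥0∞}
    (hG : ∀ᵐ ω ∂P, ∀ L : Filter (ℕ × X), L.IsCountablyGenerated → Tendsto Prod.fst L atTop →
      (∀ j t, Tendsto (fun p => Psi T a (f j) p.1 p.2 t) L (𝓝 (integ m (f j) * M ω t))) →
      ∀ r < G' ω, ∀ᶠ p in L, r < G p.1 p.2)
    {r : ℝ≥0∞} (hr : r < m A * ∫⁻ ω, G' ω ∂P) : ∀ᶠ n in atTop, r < ∫⁻ x in A, G n x ∂m := by
  have hA0 : m A ≠ 0 := by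
    rintro h
    simp [h] at hr
  rw [mul_comm, ← ENNReal.div_lt_iff (.inl hA0) (.inl hA)] at hr
  have := ProbabilityTheory.cond_isProbabilityMeasure_of_finite hA0 hA
  filter_upwards [eventually_lt_lintegral_of_hasStrongLimit hT hM hMcont hM0
    (Q := ProbabilityTheory.cond m A) ProbabilityTheory.cond_absolutelyContinuous hconv hf hG hr]
    with n hn
  rwa [ProbabilityTheory.cond, lintegral_smul_measure, smul_eq_mul,
    ENNReal.div_lt_iff (.inl hA0) (.inl hA), mul_right_comm, ENNReal.inv_mul_cancel hA0 hA,
    one_mul] at hn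

theorem eventually_lt_setLIntegral_comp_Psi_one {A : Set X} (hA : m A ≠ ∞) (hT : Measurable T)
    (hM : Measurable M) (hMcont : ∀ᵐ ω ∂P, Continuous (M ω).toFun) (hM0 : ∀ᵐ ω ∂P, M ω 0 = 0)
    (hconv : HasStrongLimit m T a P M) {f : X → ℝ≥0} (hf : IsL1Pos m f) {φ : ℝ≥0 → ℝ≥0∞}
    (hφ : LowerSemicontinuous φ) {r : ℝ≥0∞} (hr : r < m A * ∫⁻ ω, φ (integ m f * M ω 1) ∂P) :
    ∀ᶠ n in atTop, r < ∫⁻ x in A, φ (Psi T a f n x 1) ∂m :=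
  eventually_lt_setLIntegral_of_hasStrongLimit (κ := Unit) hA hT hM hMcont hM0 hconv (fun _ => hf)
    (ae_of_all _ fun _ _ _ _ hL s hs => (hL () 1).eventually (hφ _ s hs)) hr

end Fatou

/-! ### Laws of the occupation times at visits -/

namespace IsWeaklyRationallyErgodic

variable {X : Type*} [MeasurableSpace X] {m : Measure X} {T : X → X} {a : ℕ → ℝ≥0}
  {R : Set (Set X)}

theorem eventually_ne_zero (hT : IsWeaklyRationallyErgodic m T a R) : ∀ᶠ n in atTop, a n ≠ 0 :=
  (eventually_ge_atTop 1).mono fun n hn => (hT.pos n hn).ne'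

theorem exists_mem_measure_ne_zero [SigmaFinite m] (hT : IsWeaklyRationallyErgodic m T a R)
    (hm : m ≠ 0) : ∃ A ∈ R, m A ≠ 0 := by
  obtain ⟨E, hE, -, hE0, hEtop⟩ := Measure.exists_subset_measure_lt_top MeasurableSet.univ
    (bot_lt_iff_ne_bot.2 fun h => hm (Measure.measure_univ_eq_zero.1 h))
  obtain ⟨A, hA, hAE⟩ := hT.dense E hE hEtop (m E) hE0
  refine ⟨A, hA, fun h => hAE.not_ge ?_⟩
  calc m E ≤ m (A ∪ symmDiff A E) := measure_mono fun x hx => by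
        by_cases hxA : x ∈ A
        · exact .inl hxA
        · exact .inr (.inr ⟨hx, hxA⟩)
    _ ≤ m A + m (symmDiff A E) := measure_union_le _ _
    _ = m (symmDiff A E) := by rw [h, zero_add]

theorem isLocallyUniformlyRegularlyVarying [SigmaFinite m] {γ : ℝ}
    (hT : IsWeaklyRationallyErgodic m T a R) (hm : m ≠ 0) (ha : IsRegularlyVarying γ a) :
    IsLocallyUniformlyRegularlyVarying γ a := by
  obtain ⟨A, hA, hA0⟩ := hT.exists_mem_measure_ne_zero hm
  have hA1 : m.real A ≠ 0 := ENNReal.toReal_ne_zero.2 ⟨hA0, (hT.measure_lt_top A hA).ne⟩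
  refine ha.isLocallyUniformlyRegularlyVarying
    (S := fun n => ∑ k ∈ Finset.range n, m.real (A ∩ T^[k] ⁻¹' A))
    (fun n n' h => Finset.sum_le_sum_of_subset_of_nonneg (Finset.range_mono h)
      fun _ _ _ => measureReal_nonneg)
    (fun n => Finset.sum_nonneg fun _ _ => measureReal_nonneg) (mul_ne_zero hA1 hA1) ?_
  simpa only [one_div, inv_mul_eq_div] using hT.tendsto A hA A hA

theorem setLIntegral_Psi_indicator_one (hT : IsWeaklyRationallyErgodic m T a R) {A B : Set X}
    (hA : A ∈ R) (hB : MeasurableSet B) (n : ℕ) :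
    ∫⁻ x in A, Psi T a (B.indicator 1) n x 1 ∂m =
      ENNReal.ofReal (1 / (a n : ℝ) * ∑ k ∈ Finset.range n, m.real (A ∩ T^[k] ⁻¹' B)) := by
  have hBk (k : ℕ) : MeasurableSet (T^[k] ⁻¹' B) :=
    hT.measurePreserving.measurable.iterate k hB
  have hterm (k : ℕ) (x : X) : ((B.indicator (1 : X → ℝ≥0) (T^[k] x) / a n : ℝ≥0) : ℝ≥0∞) =
      ((a n)⁻¹ : ℝ≥0) * (T^[k] ⁻¹' B).indicator 1 x := by
    by_cases hx : T^[k] x ∈ B <;> simp [hx]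
  simp_rw [← visitMeasure_univ, ← lintegral_one, lintegral_visitMeasure, mul_one, hterm]
  rw [lintegral_finsetSum _ fun k _ => (measurable_one.indicator (hBk k)).const_mul _,
    ENNReal.ofReal_mul (by positivity), ENNReal.ofReal_sum_of_nonneg fun _ _ => measureReal_nonneg,
    Finset.mul_sum]
  refine Finset.sum_congr rfl fun k _ => ?_
  rw [lintegral_const_mul' _ _ ENNReal.coe_ne_top, lintegral_indicator_one (hBk k),
    Measure.restrict_apply (hBk k), inter_comm, ofReal_measureReal
      (measure_ne_top_of_subset inter_subset_left (hT.measure_lt_top A hA).ne), one_div,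
    ← NNReal.coe_inv, ENNReal.ofReal_coe_nnreal]

theorem tendsto_setLIntegral_Psi_indicator_one (hT : IsWeaklyRationallyErgodic m T a R)
    {A B : Set X} (hA : A ∈ R) (hB : B ∈ R) :
    Tendsto (fun n => ∫⁻ x in A, Psi T a (B.indicator 1) n x 1 ∂m) atTop (𝓝 (m A * m B)) := by
  have h := ENNReal.tendsto_ofReal (hT.tendsto A hA B hB)
  rw [ENNReal.ofReal_mul measureReal_nonneg, ofReal_measureReal (hT.measure_lt_top A hA).ne,
    ofReal_measureReal (hT.measure_lt_top B hB).ne] at h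
  simpa only [hT.setLIntegral_Psi_indicator_one hA (hT.measurableSet B hB)] using h

end IsWeaklyRationallyErgodic

/-- The law of the rescaled occupation time `Psi T a f k` at a visit from `A` to `B`: the sum over
`k = 1, …, n` of its laws under `m` restricted to `A ∩ T⁻ᵏ B`, divided by `a n`. -/
def visitLaw {X : Type*} [MeasurableSpace X] (m : Measure X) (T : X → X) (a : ℕ → ℝ≥0)
    (f : X → ℝ≥0) (A B : Set X) (n : ℕ) : Measure DOne :=
  (a n)⁻¹ • ∑ k ∈ Finset.Icc 1 n,
    (m.restrict (A ∩ T^[k] ⁻¹' B)).map fun x => (Psi T a f k x).toOne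

section VisitLaw

variable {X : Type*} [MeasurableSpace X] {m : Measure X} {T : X → X} {a : ℕ → ℝ≥0}
  {f : X → ℝ≥0} {A B : Set X}

theorem isFiniteMeasure_visitLaw (hA : m A ≠ ∞) (n : ℕ) :
    IsFiniteMeasure (visitLaw m T a f A B n) := by
  have (k : ℕ) : IsFiniteMeasure (m.restrict (A ∩ T^[k] ⁻¹' B)) :=
    isFiniteMeasure_restrict.2 (measure_ne_top_of_subset inter_subset_left hA)
  unfold visitLaw
  infer_instance

theorem integral_visitLaw (hT : Measurable T) (hf : Measurable f) (hA : m A ≠ ∞)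
    (hB : MeasurableSet B) {g : DOne → ℝ} (hg : Measurable g) {C : ℝ} (hgC : ∀ ξ, |g ξ| ≤ C)
    (n : ℕ) : ∫ ξ, g ξ ∂visitLaw m T a f A B n = 1 / (a n : ℝ) * ∑ k ∈ Finset.Icc 1 n,
      ∫ x in A, g (Psi T a f k x).toOne * B.indicator 1 (T^[k] x) ∂m := by
  have hfin (k : ℕ) : IsFiniteMeasure (m.restrict (A ∩ T^[k] ⁻¹' B)) :=
    isFiniteMeasure_restrict.2 (measure_ne_top_of_subset inter_subset_left hA)
  rw [visitLaw, integral_smul_nnreal_measure, integral_finsetSum_measure fun k _ =>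
    .of_bound hg.aestronglyMeasurable C (ae_of_all _ hgC), one_div, ← NNReal.coe_inv]
  congr 1
  refine Finset.sum_congr rfl fun k _ => ?_
  have hBk : MeasurableSet (T^[k] ⁻¹' B) := hT.iterate k hB
  have hm : Measurable fun x => (Psi T a f k x).toOne :=
    measurable_toOne.comp (measurable_Psi hT hf k)
  rw [integral_map hm.aemeasurable hg.aestronglyMeasurable, inter_comm,
    ← Measure.restrict_restrict hBk, ← integral_indicator hBk]
  refine integral_congr_ae (ae_of_all _ fun x => ?_)
  by_cases hx : T^[k] x ∈ B <;> simp [hx]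

theorem lintegral_visitLaw (hT : Measurable T) (hf : Measurable f) (hB : MeasurableSet B)
    {h : DOne → ℝ≥0∞} (hh : Measurable h) (n : ℕ) :
    ∫⁻ ξ, h ξ ∂visitLaw m T a f A B n = ∫⁻ x in A, ∫⁻ i, h (Psi T a f (i + 1) x).toOne
      ∂visitMeasure T a ((T ⁻¹' B).indicator 1) n x ∂m := by
  have hm (k : ℕ) : Measurable fun x => (Psi T a f k x).toOne :=
    measurable_toOne.comp (measurable_Psi hT hf k)
  have hhm (k : ℕ) : Measurable fun x => h (Psi T a f k x).toOne := hh.comp (hm k)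
  have hterm (i : ℕ) (x : X) : (((T ⁻¹' B).indicator 1 (T^[i] x) / a n : ℝ≥0) : ℝ≥0∞) *
      h (Psi T a f (i + 1) x).toOne = ((a n)⁻¹ : ℝ≥0) *
        (T^[i + 1] ⁻¹' B).indicator (fun x => h (Psi T a f (i + 1) x).toOne) x := by
    rw [Function.iterate_succ', preimage_comp]
    by_cases hx : T (T^[i] x) ∈ B <;> simp [hx]
  have hBk (k : ℕ) : MeasurableSet (T^[k] ⁻¹' B) := hT.iterate k hB
  simp only [lintegral_visitMeasure, hterm]
  rw [lintegral_finsetSum _ fun i _ => ((hhm _).indicator (hBk _)).const_mul _, visitLaw,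
    lintegral_smul_measure, lintegral_finsetSum_measure, ENNReal.smul_def, smul_eq_mul,
    Finset.mul_sum, Finset.range_eq_Ico, Finset.sum_Ico_add' (fun k => ∫⁻ x in A,
      ((a n)⁻¹ : ℝ≥0) * (T^[k] ⁻¹' B).indicator (fun x => h (Psi T a f k x).toOne) x ∂m) 0 n 1]
  refine Finset.sum_congr rfl fun k _ => ?_
  rw [lintegral_const_mul' _ _ ENNReal.coe_ne_top, lintegral_indicator (hBk k),
    Measure.restrict_restrict (hBk k), inter_comm, lintegral_map hh (hm k)]

theorem tendsto_visitLaw_univ {R : Set (Set X)} (hT : IsWeaklyRationallyErgodic m T a R)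
    (hA : A ∈ R) (hB : B ∈ R) (hf : Measurable f) :
    Tendsto (fun n => visitLaw m T a f A B n univ) atTop (𝓝 (m A * m B)) := by
  have hB' := hT.measurableSet B hB
  rw [← hT.measurePreserving.measure_preimage hB'.nullMeasurableSet]
  refine (hT.tendsto_setLIntegral_Psi_indicator_one hA (hT.invariant B hB)).congr fun n => ?_
  rw [← lintegral_one, lintegral_visitLaw hT.measurePreserving.measurable hf hB' measurable_const]
  simp only [lintegral_one, visitMeasure_univ]

variable [SigmaFinite m] {R : Set (Set X)} {Ω : Type*} [MeasurableSpace Ω] {P : Measure Ω}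
  [IsProbabilityMeasure P] {M : Ω → DInf} {γ : ℝ}

theorem eventually_lt_lintegral_visitLaw (hT : IsWeaklyRationallyErgodic m T a R)
    (hreg : IsLocallyUniformlyRegularlyVarying γ a) (hM : Measurable M)
    (hMcont : ∀ᵐ ω ∂P, Continuous (M ω).toFun) (hM0 : ∀ᵐ ω ∂P, M ω 0 = 0)
    (hconv : HasStrongLimit m T a P M) (hA : A ∈ R) (hB : B ∈ R) (hf : IsL1Pos m f)
    {h : DOne → ℝ≥0∞} (hh : Measurable h)
    (hh' : ∀ ξ : DOne, Continuous ξ.toFun → LowerSemicontinuousAt h ξ) {r : ℝ≥0∞}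
    (hr : r < m A * m B * ∫⁻ ω, ∫⁻ t in Icc (0 : ℝ≥0) 1,
      h (((M ω).dilate γ t).toOne.scale (integ m f)) ∂(M ω).measure ∂P) :
    ∀ᶠ n in atTop, r < ∫⁻ ξ, h ξ ∂visitLaw m T a f A B n := by
  have hTm := hT.measurePreserving.measurable
  have hB' := hT.measurableSet B hB
  have hb : IsL1Pos m ((T ⁻¹' B).indicator 1) := isL1Pos_indicator (hTm hB')
    (hT.measure_lt_top _ (hT.invariant B hB))
  have hbB : integ m ((T ⁻¹' B).indicator 1) = (m B).toNNReal := by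
    rw [integ_indicator (hTm hB'),
      hT.measurePreserving.measure_preimage hB'.nullMeasurableSet]
  simp only [lintegral_visitLaw hTm hf.1 hB' hh]
  refine eventually_lt_setLIntegral_of_hasStrongLimit (hT.measure_lt_top A hA).ne
    (f := ![f, (T ⁻¹' B).indicator 1]) hTm hM hMcont hM0 hconv (Fin.forall_fin_two.2 ⟨hf, hb⟩)
    (G' := fun ω => ∫⁻ t in Icc (0 : ℝ≥0) 1, h (((M ω).dilate γ t).toOne.scale (integ m f))
      ∂((m B).toNNReal • (M ω).measure)) ?_ ?_
  · filter_upwards [hMcont, hM0] with ω hω hω0 L _ hL hlim r hr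
    refine eventually_lt_lintegral_visitMeasure hreg hT.eventually_ne_zero hω hω0 hL (hlim 0)
      (fun s => ?_) hh' hr
    rw [← hbB]
    exact hlim 1 s
  · simp only [Measure.restrict_smul, lintegral_smul_measure, ENNReal.smul_def, smul_eq_mul,
      ENNReal.coe_toNNReal (hT.measure_lt_top B hB).ne]
    rwa [lintegral_const_mul' _ _ (hT.measure_lt_top B hB).ne, ← mul_assoc]

end VisitLaw

/-! ### The limit has expectation one at time one -/

theorem add_le_of_forall_lt_eventually_lt {J : Type*} {L : Filter J} [L.NeBot] {u v : J → ℝ≥0∞}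
    {y z b : ℝ≥0∞} (hu : ∀ r < y, ∀ᶠ j in L, r < u j) (hv : Tendsto v L (𝓝 z))
    (h : ∀ᶠ j in L, u j + v j ≤ b) : y + z ≤ b := by
  have hmin : Tendsto (fun j => min (u j) y) L (𝓝 y) :=
    tendsto_order.2 ⟨fun r hr => (hu r hr).mono fun j hj => lt_min hj hr,
      fun r hr => .of_forall fun j => (min_le_right _ _).trans_lt hr⟩
  exact le_of_tendsto (hmin.add hv)
    (h.mono fun j hj => (add_le_add_left (min_le_left _ _) _).trans hj)

theorem lintegral_const_sub_add_lintegral {S : Type*} [MeasurableSpace S] {μ : Measure S}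
    {u : S → ℝ≥0∞} (hu : Measurable u) (K : ℝ≥0∞) :
    ∫⁻ x, (K - u x) ∂μ + ∫⁻ x, u x ∂μ = K * μ univ + ∫⁻ x, (u x - K) ∂μ := by
  rw [← lintegral_add_right _ hu, ← lintegral_const, ← lintegral_add_left measurable_const]
  simp only [tsub_add_eq_max, add_tsub_eq_max]

namespace IsWeaklyRationallyErgodic

variable {X Ω : Type*} [MeasurableSpace X] [MeasurableSpace Ω] {m : Measure X} {P : Measure Ω}
  {T : X → X} {a : ℕ → ℝ≥0} {R : Set (Set X)} {M : Ω → DInf} {A : Set X}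

theorem exists_eventually_setLIntegral_Psi_one_sub_natCast_le
    (hT : IsWeaklyRationallyErgodic m T a R) (hA : A ∈ R) {ε : ℝ≥0∞} (hε : ε ≠ 0) :
    ∃ K : ℕ, ∀ᶠ n in atTop, ∫⁻ x in A, (Psi T a (A.indicator 1) n x 1 - K : ℝ≥0∞) ∂m ≤ ε := by
  have hA' := hT.measure_lt_top A hA
  have hu (n : ℕ) := (measurable_eval 1).comp (measurable_Psi (a := a)
    hT.measurePreserving.measurable (measurable_one.indicator (hT.measurableSet A hA)) n)
  refine exists_eventually_lintegral_sub_natCast_le (v := fun _ => m A)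
    (fun n => (hu n).coe_nnreal_ennreal) ?_ (fun C hC => ?_) hε
  · simpa using (ENNReal.mul_lt_top hA' hA').ne
  · have hCA := hT.hereditary A hA (C ∩ A) (hC.inter (hT.measurableSet A hA)) inter_subset_right
    simp only [Measure.restrict_restrict hC, lintegral_const, Measure.restrict_apply_univ]
    rw [mul_comm]
    exact hT.tendsto_setLIntegral_Psi_indicator_one hCA hA

variable [SigmaFinite m] [IsProbabilityMeasure P]

theorem lintegral_limit_one_le (hT : IsWeaklyRationallyErgodic m T a R) (hM : Measurable M)
    (hMcont : ∀ᵐ ω ∂P, Continuous (M ω).toFun) (hM0 : ∀ᵐ ω ∂P, M ω 0 = 0)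
    (hconv : HasStrongLimit m T a P M) (hA : A ∈ R) (hA0 : m A ≠ 0) : ∫⁻ ω, M ω 1 ∂P ≤ 1 := by
  have hA' := (hT.measure_lt_top A hA).ne
  have hf := isL1Pos_indicator (hT.measurableSet A hA) (hT.measure_lt_top A hA)
  have hle : m A * ∫⁻ ω, (integ m (A.indicator 1) * M ω 1 : ℝ≥0) ∂P ≤ m A * m A :=
    le_of_forall_lt_imp_le_of_dense fun r hr =>
      ge_of_tendsto (hT.tendsto_setLIntegral_Psi_indicator_one hA hA)
        ((eventually_lt_setLIntegral_comp_Psi_one hA' hT.measurePreserving.measurable hM hMcont hM0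
          hconv hf ENNReal.continuous_coe.lowerSemicontinuous hr).mono fun _ => le_of_lt)
  simp only [ENNReal.coe_mul, integ_indicator (hT.measurableSet A hA),
    ENNReal.coe_toNNReal hA'] at hle
  rw [lintegral_const_mul' _ _ hA', ENNReal.mul_le_mul_iff_right hA0 hA'] at hle
  exact (ENNReal.mul_le_mul_iff_right hA0 hA').1 (hle.trans_eq (mul_one _).symm)

theorem one_le_lintegral_limit_one (hT : IsWeaklyRationallyErgodic m T a R) (hM : Measurable M)
    (hMcont : ∀ᵐ ω ∂P, Continuous (M ω).toFun) (hM0 : ∀ᵐ ω ∂P, M ω 0 = 0)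
    (hconv : HasStrongLimit m T a P M) (hA : A ∈ R) (hA0 : m A ≠ 0) : 1 ≤ ∫⁻ ω, M ω 1 ∂P := by
  have hA' := (hT.measure_lt_top A hA).ne
  have hf := isL1Pos_indicator (hT.measurableSet A hA) (hT.measure_lt_top A hA)
  have hc : (integ m (A.indicator 1) : ℝ≥0∞) = m A := by
    rw [integ_indicator (hT.measurableSet A hA), ENNReal.coe_toNNReal hA']
  suffices h : m A * m A ≤ m A * m A * ∫⁻ ω, M ω 1 ∂P from
    (ENNReal.mul_le_mul_iff_right (mul_ne_zero hA0 hA0) (ENNReal.mul_ne_top hA' hA')).1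
      ((mul_one _).trans_le h)
  refine ENNReal.le_of_forall_pos_le_add fun ε hε _ => ?_
  obtain ⟨K, hK⟩ := hT.exists_eventually_setLIntegral_Psi_one_sub_natCast_le hA
    (ENNReal.coe_ne_zero.2 hε.ne')
  set u := fun n x => (Psi T a (A.indicator 1) n x 1 : ℝ≥0∞)
  set I := ∫⁻ ω, ((K : ℝ≥0∞) - (integ m (A.indicator 1) * M ω 1 : ℝ≥0)) ∂P
  have hu (n : ℕ) : Measurable (u n) := ((measurable_eval 1).comp
    (measurable_Psi hT.measurePreserving.measurable hf.1 n)).coe_nnreal_ennreal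
  have hφ : LowerSemicontinuous fun s : ℝ≥0 => (K : ℝ≥0∞) - s :=
    ((ENNReal.continuous_sub_left (ENNReal.natCast_ne_top K)).comp
      ENNReal.continuous_coe).lowerSemicontinuous
  -- Fatou's lemma for `K - u n`; what the truncation loses, `u n - K`, is uniformly small.
  have hup : m A * I + m A * m A ≤ K * m A + ε := by
    refine add_le_of_forall_lt_eventually_lt (fun r hr => eventually_lt_setLIntegral_comp_Psi_one
      hA' hT.measurePreserving.measurable hM hMcont hM0 hconv hf hφ hr)
      (hT.tendsto_setLIntegral_Psi_indicator_one hA hA) ?_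
    filter_upwards [hK] with n hn
    rw [lintegral_const_sub_add_lintegral (hu n), Measure.restrict_apply_univ]
    gcongr
  have hI : K * m A ≤ m A * I + m A * m A * ∫⁻ ω, M ω 1 ∂P := by
    have hcM : Measurable fun ω => ((integ m (A.indicator 1) * M ω 1 : ℝ≥0) : ℝ≥0∞) :=
      (((measurable_eval 1).comp hM).const_mul _).coe_nnreal_ennreal
    have hK' : (K : ℝ≥0∞) ≤ I + m A * ∫⁻ ω, M ω 1 ∂P := by
      rw [← lintegral_const_mul' _ _ hA', ← hc]
      simp only [← ENNReal.coe_mul]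
      rw [lintegral_const_sub_add_lintegral hcM, measure_univ, mul_one]
      exact le_self_add
    calc K * m A ≤ (I + m A * ∫⁻ ω, M ω 1 ∂P) * m A := by gcongr
      _ = m A * I + m A * m A * ∫⁻ ω, M ω 1 ∂P := by ring
  have hKA : (K : ℝ≥0∞) * m A ≠ ∞ := ENNReal.mul_ne_top (ENNReal.natCast_ne_top K) hA'
  refine (ENNReal.add_le_add_iff_left hKA).1 ?_
  calc K * m A + m A * m A ≤ (m A * I + m A * m A * ∫⁻ ω, M ω 1 ∂P) + m A * m A := by gcongr
    _ = (m A * I + m A * m A) + m A * m A * ∫⁻ ω, M ω 1 ∂P := by ring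
    _ ≤ (K * m A + ε) + m A * m A * ∫⁻ ω, M ω 1 ∂P := by gcongr
    _ = K * m A + (m A * m A * ∫⁻ ω, M ω 1 ∂P + ε) := by ring

theorem lintegral_limit_one (hT : IsWeaklyRationallyErgodic m T a R) (hm : m ≠ 0)
    (hM : Measurable M) (hMcont : ∀ᵐ ω ∂P, Continuous (M ω).toFun) (hM0 : ∀ᵐ ω ∂P, M ω 0 = 0)
    (hconv : HasStrongLimit m T a P M) : ∫⁻ ω, M ω 1 ∂P = 1 := by
  obtain ⟨A, hA, hA0⟩ := hT.exists_mem_measure_ne_zero hm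
  exact (hT.lintegral_limit_one_le hM hMcont hM0 hconv hA hA0).antisymm
    (hT.one_le_lintegral_limit_one hM hMcont hM0 hconv hA hA0)

end IsWeaklyRationallyErgodic

/-! ### Convergence of integrals from Fatou bounds -/

section Sandwich

variable {S J : Type*} [MeasurableSpace S] {L : Filter J} {ν : J → Measure S}
  [∀ j, IsFiniteMeasure (ν j)] {μ : Measure S} [IsFiniteMeasure μ] {g : S → ℝ} {C : ℝ}

theorem lintegral_ofReal_const_add (hg : Measurable g) (hC : ∀ x, |g x| ≤ C) :
    ∫⁻ x, ENNReal.ofReal (C + g x) ∂μ = ENNReal.ofReal (C * μ.real univ + ∫ x, g x ∂μ) := by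
  have hgi : Integrable g μ := .of_bound hg.aestronglyMeasurable C (ae_of_all _ hC)
  rw [mul_comm, ← smul_eq_mul, ← integral_const, ← integral_add (integrable_const C) hgi]
  exact (ofReal_integral_eq_lintegral_ofReal ((integrable_const C).add hgi)
    (ae_of_all _ fun x => neg_le_iff_add_nonneg'.1 (neg_le_of_abs_le (hC x)))).symm

theorem eventually_lt_integral_of_eventually_lt_lintegral (hg : Measurable g)
    (hC : ∀ x, |g x| ≤ C) (huniv : Tendsto (fun j => ν j univ) L (𝓝 (μ univ)))
    (h : ∀ r < ∫⁻ x, ENNReal.ofReal (C + g x) ∂μ, ∀ᶠ j in L,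
      r < ∫⁻ x, ENNReal.ofReal (C + g x) ∂ν j) {r : ℝ} (hr : r < ∫ x, g x ∂μ) :
    ∀ᶠ j in L, r < ∫ x, g x ∂ν j := by
  simp only [lintegral_ofReal_const_add hg hC] at h
  have hmass : Tendsto (fun j => C * (ν j).real univ) L (𝓝 (C * μ.real univ)) :=
    ((ENNReal.tendsto_toReal (measure_ne_top μ univ)).comp huniv).const_mul C
  have hnonneg (μ' : Measure S) [IsFiniteMeasure μ'] : 0 ≤ C * μ'.real univ + ∫ x, g x ∂μ' := by
    have hgC : ‖∫ x, g x ∂μ'‖ ≤ C * μ'.real univ :=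
      norm_integral_le_of_norm_le_const (ae_of_all _ hC)
    linarith [neg_le_of_abs_le hgC]
  have hsum (s : ℝ) (hs : s < C * μ.real univ + ∫ x, g x ∂μ) :
      ∀ᶠ j in L, s < C * (ν j).real univ + ∫ x, g x ∂ν j := by
    rcases lt_or_ge s 0 with hs0 | hs0
    · exact .of_forall fun j => hs0.trans_le (hnonneg (ν j))
    · refine (h _ ((ENNReal.ofReal_lt_ofReal_iff_of_nonneg hs0).2 hs)).mono fun j hj => ?_
      exact (ENNReal.ofReal_lt_ofReal_iff_of_nonneg hs0).1 hj
  filter_upwards [hsum (C * μ.real univ + (r + ∫ x, g x ∂μ) / 2) (by linarith),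
    hmass.eventually_lt_const (u := C * μ.real univ + (∫ x, g x ∂μ - r) / 2) (by linarith)]
    with j hj hj'
  linarith

theorem tendsto_integral_of_eventually_lt_lintegral (hg : Measurable g) (hC : ∀ x, |g x| ≤ C)
    (huniv : Tendsto (fun j => ν j univ) L (𝓝 (μ univ)))
    (hadd : ∀ r < ∫⁻ x, ENNReal.ofReal (C + g x) ∂μ, ∀ᶠ j in L,
      r < ∫⁻ x, ENNReal.ofReal (C + g x) ∂ν j)
    (hsub : ∀ r < ∫⁻ x, ENNReal.ofReal (C - g x) ∂μ, ∀ᶠ j in L,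
      r < ∫⁻ x, ENNReal.ofReal (C - g x) ∂ν j) :
    Tendsto (fun j => ∫ x, g x ∂ν j) L (𝓝 (∫ x, g x ∂μ)) := by
  refine tendsto_order.2 ⟨fun r => eventually_lt_integral_of_eventually_lt_lintegral hg hC huniv
    hadd, fun r hr => ?_⟩
  have h := eventually_lt_integral_of_eventually_lt_lintegral (g := fun x => -g x) (r := -r) hg.neg
    (by simpa only [abs_neg] using hC) huniv (by simpa only [← sub_eq_add_neg] using hsub)
    (by rw [integral_neg]; exact neg_lt_neg hr)
  simpa only [integral_neg, neg_lt_neg_iff] using h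

end Sandwich

/-! ### Measurable versions of continuous functions on `D_{↑,1}` -/

/-- The step function with values `v₀ ≤ max v₀ v₁ ≤ …` on intervals of length `1 / N`; running
maxima make it defined, and continuous, for every `v`. -/
def stepFun (N : ℕ) (v : ℕ → ℝ≥0) : DOne where
  toFun t := partialSups v ⌊(N : ℝ≥0) * t⌋₊
  mono := fun _ _ h => (partialSups v).monotone
    (Nat.floor_mono (mul_le_mul_right (Subtype.coe_le_coe.2 h) _))
  right_cont := fun x => (floor_right_cont N (partialSups v) (x : ℝ≥0)).comp
    continuous_subtype_val.continuousWithinAt (fun _ h => h)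

theorem continuous_stepFun (N : ℕ) : Continuous (stepFun N) := by
  refine continuous_iff_continuousAt.2 fun v => tendsto_nhds_of_tendstoUniformly ?_
  have hcoord (i : ℕ) : Tendsto (fun w : ℕ → ℝ≥0 => partialSups w i) (𝓝 v)
      (𝓝 (partialSups v i)) :=
    (Continuous.partialSups_apply (f := fun k (w : ℕ → ℝ≥0) => w k)
      fun k _ => continuous_apply k).tendsto v
  refine Metric.tendstoUniformly_iff.2 fun ε hε => ?_
  filter_upwards [(Finset.eventually_all (Finset.range (N + 1))).2 fun i _ =>
    Metric.tendsto_nhds.1 (hcoord i) ε hε] with w hw t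
  rw [dist_comm]
  exact hw _ (Finset.mem_range.2 (Nat.lt_succ_of_le
    (Nat.floor_le_of_le (mul_le_of_le_one_right zero_le t.2.2))))

/-- The step function agreeing with `ξ` at the multiples of `1 / n`. -/
def stepApprox (n : ℕ) (ξ : DOne) : DOne := stepFun n fun i => ξ.extend (i / n)

theorem stepApprox_apply (n : ℕ) (ξ : DOne) (t : UnitI) :
    stepApprox n ξ t = ξ.extend (⌊(n : ℝ≥0) * t⌋₊ / n) := by
  have hmono : Monotone fun i : ℕ => ξ.extend ((i : ℝ≥0) / n) := fun i j hij =>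
    ξ.extend.mono (by gcongr)
  simp only [stepApprox, stepFun, hmono.partialSups_eq]

theorem measurable_comp_stepApprox {β : Type*} [TopologicalSpace β] [MeasurableSpace β]
    [BorelSpace β] {h : DOne → β} (hh : Continuous h) (n : ℕ) :
    Measurable fun ξ => h (stepApprox n ξ) :=
  (hh.comp (continuous_stepFun n)).measurable.comp
    (measurable_pi_lambda _ fun _ => (measurable_eval _).comp measurable_extend)

theorem tendsto_stepApprox {ξ : DOne} (hξ : Continuous ξ.toFun) :
    Tendsto (fun n => stepApprox n ξ) atTop (𝓝 ξ) := by
  refine tendsto_nhds_of_forall_tendsto_apply hξ fun t => ?_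
  have hfloor : Tendsto (fun n : ℕ => (⌊(n : ℝ≥0) * t⌋₊ / n : ℝ≥0)) atTop (𝓝 t) := by
    rw [← NNReal.tendsto_coe]
    refine ((tendsto_nat_floor_mul_div_atTop (t : ℝ≥0).coe_nonneg).comp
      tendsto_natCast_atTop_atTop).congr fun n => ?_
    rw [Function.comp_apply, mul_comm]
    rfl
  have hextend : Continuous ξ.extend.toFun := hξ.comp continuous_projIcc
  simpa only [stepApprox_apply, Function.comp_def, NonDec.extend_coe] using
    (hextend.tendsto (t : ℝ≥0)).comp hfloor

theorem uniformContinuous_extend {ξ : DOne} (hξ : Continuous ξ.toFun) :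
    UniformContinuous ξ.extend.toFun := by
  refine (CompactSpace.uniformContinuous_of_continuous hξ).comp
    (LipschitzWith.of_dist_le_mul (K := 1) fun s t => ?_).uniformContinuous
  rw [NNReal.coe_one, one_mul, Subtype.dist_eq, NNReal.dist_eq, NNReal.dist_eq]
  simp only [coe_projIcc, max_eq_right zero_le, min_comm (1 : ℝ≥0), NNReal.coe_min]
  exact abs_inf_sub_inf_le_abs (s : ℝ) t _

theorem exists_forall_increment_le {ξ : DInf} (hξ : UniformContinuous ξ.toFun) (k : ℕ) :
    ∃ n : ℕ, ∀ s, ξ (s + 1 / (n + 1)) ≤ ξ s + 1 / (k + 1) := by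
  obtain ⟨δ, hδ, hlt⟩ := Metric.uniformContinuous_iff.1 hξ (1 / ((k : ℝ) + 1)) (by positivity)
  obtain ⟨n, hn⟩ := exists_nat_one_div_lt hδ
  refine ⟨n, fun s => ?_⟩
  have hdist : dist (ξ (s + 1 / (n + 1))) (ξ s) < 1 / ((k : ℝ) + 1) := hlt <| by
    simpa [NNReal.dist_eq, abs_of_nonneg (show (0 : ℝ) ≤ n + 1 by positivity)] using hn
  exact_mod_cast sub_le_iff_le_add'.1 ((le_abs_self _).trans hdist.le)

theorem continuous_of_forall_exists_increment_le {ξ : DInf}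
    (h : ∀ k : ℕ, ∃ n : ℕ, ∀ i,
      ξ (denseSeq ℝ≥0 i + 1 / (n + 1)) ≤ ξ (denseSeq ℝ≥0 i) + 1 / (k + 1)) :
    Continuous ξ.toFun := by
  refine continuous_iff_continuousAt.2 fun t => continuousAt_iff_continuous_left_right.2
    ⟨?_, ξ.right_cont t⟩
  rcases eq_or_ne t 0 with rfl | ht
  · rw [← bot_eq_zero, Iic_bot]
    exact continuousWithinAt_singleton
  refine tendsto_order.2 ⟨fun c hc => ?_, fun c hc => ?_⟩
  · obtain ⟨k, hk⟩ := exists_nat_one_div_lt (tsub_pos_of_lt hc)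
    obtain ⟨n, hn⟩ := h k
    obtain ⟨i, hi, hit⟩ := exists_denseSeq_btwn
      (tsub_lt_self (pos_iff_ne_zero.2 ht) (show 0 < 1 / ((n : ℝ≥0) + 1) by positivity))
    filter_upwards [Ioc_mem_nhdsLE hit] with s hs
    have hinc : ξ t ≤ ξ s + 1 / (k + 1) := calc
      ξ t ≤ ξ (denseSeq ℝ≥0 i + 1 / (n + 1)) := ξ.mono (tsub_le_iff_right.1 hi.le)
      _ ≤ ξ (denseSeq ℝ≥0 i) + 1 / (k + 1) := hn i
      _ ≤ ξ s + 1 / (k + 1) := by gcongr; exact ξ.mono hs.1.le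
    exact lt_of_add_lt_add_right ((lt_tsub_iff_left.1 hk).trans_le hinc)
  · filter_upwards [self_mem_nhdsWithin] with s hs
    exact (ξ.mono hs).trans_lt hc

theorem continuous_iff_forall_exists_increment_le {ξ : DOne} :
    Continuous ξ.toFun ↔ ∀ k : ℕ, ∃ n : ℕ, ∀ i,
      ξ.extend (denseSeq ℝ≥0 i + 1 / (n + 1)) ≤ ξ.extend (denseSeq ℝ≥0 i) + 1 / (k + 1) := by
  refine ⟨fun h k => ?_, fun h => ?_⟩
  · exact (exists_forall_increment_le (uniformContinuous_extend h) k).imp fun n hn i => hn _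
  · exact ((continuous_of_forall_exists_increment_le h).comp continuous_subtype_val).congr
      fun t => ξ.extend_coe t

theorem measurableSet_continuous : MeasurableSet {ξ : DOne | Continuous ξ.toFun} := by
  simp only [continuous_iff_forall_exists_increment_le, ofPred_forall, ofPred_exists]
  exact .iInter fun k => .iUnion fun n => .iInter fun i => measurableSet_le
    ((measurable_eval _).comp measurable_extend)
    (((measurable_eval _).comp measurable_extend).add_const _)

theorem exists_measurable_eq_of_continuous (h : DOne →ᵇ ℝ) :
    ∃ h' : DOne → ℝ, Measurable h' ∧ (∀ ξ, |h' ξ| ≤ ‖h‖) ∧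
      ∀ ξ : DOne, Continuous ξ.toFun → h' ξ = h ξ := by
  have hnorm : -‖h‖ ≤ ‖h‖ := neg_le_self (norm_nonneg h)
  refine ⟨fun ξ => projIcc _ _ hnorm (limsup (fun n => h (stepApprox n ξ)) atTop),
    (continuous_projIcc.measurable.comp
      (.limsup (measurable_comp_stepApprox h.continuous))).subtype_val,
    fun ξ => abs_le.2 (projIcc _ _ hnorm _).2, fun ξ hξ => ?_⟩
  have hlim : limsup (fun n => h (stepApprox n ξ)) atTop = h ξ :=
    ((h.continuous.tendsto ξ).comp (tendsto_stepApprox hξ)).limsup_eq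
  simp only [hlim]
  rw [projIcc_of_mem hnorm (abs_le.1 (h.norm_coe_le_norm ξ))]

/-! ### The tied-down law -/

section TiedDownMeasure

open ProbabilityTheory

/-- The kernel `ξ ↦ dξ` on `[0,1]`. -/
def unitKernel : Kernel DInf ℝ≥0 where
  toFun ξ := ξ.measure.restrict (Icc 0 1)
  measurable' := by
    refine Measurable.measure_of_isPiSystem ((BorelSpace.measurable_eq (α := ℝ≥0)).trans
      (borel_eq_generateFrom_Iic ℝ≥0)) isPiSystem_Iic ?_ ?_
    · rintro _ ⟨t, rfl⟩
      have hIic (ξ : DInf) : ξ.measure.restrict (Icc 0 1) (Iic t) = ξ (min t 1) := by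
        rw [Measure.restrict_apply measurableSet_Iic, ← ξ.measure_Icc_zero, ← Icc_bot,
          Icc_inter_Icc, bot_eq_zero, max_self]
      simp only [hIic]
      exact (measurable_eval _).coe_nnreal_ennreal
    · simp only [Measure.restrict_apply_univ, NonDec.measure_Icc_zero]
      exact (measurable_eval _).coe_nnreal_ennreal

theorem unitKernel_apply (ξ : DInf) : unitKernel ξ = ξ.measure.restrict (Icc 0 1) := rfl

theorem unitKernel_apply_univ (ξ : DInf) : unitKernel ξ univ = ξ 1 := by
  rw [unitKernel_apply, Measure.restrict_apply_univ, ξ.measure_Icc_zero]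

instance : IsSFiniteKernel unitKernel := by
  classical
  have hs (n : ℕ) : MeasurableSet {ξ : DInf | ⌊ξ 1⌋₊ = n} :=
    (Nat.measurable_floor.comp (measurable_eval 1)) (measurableSet_singleton n)
  have hfin (n : ℕ) : IsFiniteKernel (Kernel.piecewise (hs n) unitKernel 0) := by
    refine ⟨⟨(n + 1 : ℕ), ENNReal.natCast_lt_top _, fun ξ => ?_⟩⟩
    rw [Kernel.piecewise_apply]
    split_ifs with h
    · rw [unitKernel_apply_univ, ← show ⌊ξ 1⌋₊ = n from h]
      exact_mod_cast (Nat.lt_floor_add_one (ξ 1)).le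
    · simp
  have hsum : unitKernel = Kernel.sum fun n => Kernel.piecewise (hs n) unitKernel 0 := by
    ext ξ s hs'
    rw [Kernel.sum_apply' _ _ hs', tsum_eq_single ⌊ξ 1⌋₊ fun n hn => ?_]
    · rw [Kernel.piecewise_apply, if_pos (by rfl)]
    · rw [Kernel.piecewise_apply, if_neg (show ξ ∉ {ξ : DInf | ⌊ξ 1⌋₊ = n} from hn.symm)]
      rfl
  rw [hsum]
  exact Kernel.isSFiniteKernel_sum

variable {Ω : Type*} [MeasurableSpace Ω] {P : Measure Ω} {M : Ω → DInf}

/-- The measure `S ↦ E ∫₀¹ 1_S (Δ_{t,γ} M) dM(t)`, which is the law of `w(M)` if `E M(1) = 1`. -/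
def tiedDownMeasure (γ : ℝ) (P : Measure Ω) {M : Ω → DInf} (hM : Measurable M) : Measure DOne :=
  (P ⊗ₘ unitKernel.comap M hM).map fun p => ((M p.1).dilate γ p.2).toOne

theorem measurable_dilate_comp_toOne (γ : ℝ) (hM : Measurable M) :
    Measurable fun p : Ω × ℝ≥0 => ((M p.1).dilate γ p.2).toOne :=
  (measurable_dilate_toOne γ).comp ((hM.comp measurable_fst).prodMk measurable_snd)

variable [SFinite P]

theorem lintegral_tiedDownMeasure (γ : ℝ) (hM : Measurable M) {h : DOne → ℝ≥0∞}
    (hh : Measurable h) : ∫⁻ ξ, h ξ ∂tiedDownMeasure γ P hM =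
      ∫⁻ ω, ∫⁻ t in Icc 0 1, h ((M ω).dilate γ t).toOne ∂(M ω).measure ∂P := by
  have hmeas := measurable_dilate_comp_toOne γ hM
  rw [tiedDownMeasure, lintegral_map hh hmeas]
  exact Measure.lintegral_compProd (hh.comp hmeas)

theorem tiedDownMeasure_univ (γ : ℝ) (hM : Measurable M) :
    tiedDownMeasure γ P hM univ = ∫⁻ ω, M ω 1 ∂P := by
  rw [← lintegral_one, lintegral_tiedDownMeasure γ hM measurable_const]
  simp only [lintegral_one, Measure.restrict_apply_univ, NonDec.measure_Icc_zero]

theorem integral_tiedDownMeasure (γ : ℝ) (hM : Measurable M) {φ : DOne → ℝ}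
    (hφ : Integrable φ (tiedDownMeasure γ P hM)) : ∫ ξ, φ ξ ∂tiedDownMeasure γ P hM =
      ∫ ω, ∫ t in Icc 0 1, φ ((M ω).dilate γ t).toOne ∂(M ω).measure ∂P := by
  have hmeas := measurable_dilate_comp_toOne γ hM
  rw [tiedDownMeasure] at hφ ⊢
  rw [integral_map hmeas.aemeasurable hφ.aestronglyMeasurable]
  exact Measure.integral_compProd (hφ.comp_measurable hmeas)

theorem ae_continuous_tiedDownMeasure (γ : ℝ) (hM : Measurable M)
    (hMcont : ∀ᵐ ω ∂P, Continuous (M ω).toFun) :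
    ∀ᵐ ξ ∂tiedDownMeasure γ P hM, Continuous ξ.toFun := by
  have hmeas := measurable_dilate_comp_toOne γ hM
  refine (ae_map_iff hmeas.aemeasurable measurableSet_continuous).2
    ((Measure.ae_compProd_iff (hmeas measurableSet_continuous)).2 ?_)
  filter_upwards [hMcont] with ω hω
  exact ae_of_all _ fun t => continuous_dilate_toOne hω γ t

theorem isTiedDownLaw_tiedDownMeasure (γ : ℝ) (hM : Measurable M)
    (hMcont : ∀ᵐ ω ∂P, Continuous (M ω).toFun) [IsProbabilityMeasure (tiedDownMeasure γ P hM)] :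
    IsTiedDownLaw γ P M ⟨tiedDownMeasure γ P hM, inferInstance⟩ := by
  intro h
  obtain ⟨h', hmeas, hbdd, heq⟩ := exists_measurable_eq_of_continuous h
  calc ∫ ξ, h ξ ∂tiedDownMeasure γ P hM = ∫ ξ, h' ξ ∂tiedDownMeasure γ P hM :=
        integral_congr_ae ((ae_continuous_tiedDownMeasure γ hM hMcont).mono
          fun ξ hξ => (heq ξ hξ).symm)
    _ = ∫ ω, ∫ t in Icc 0 1, h' ((M ω).dilate γ t).toOne ∂(M ω).measure ∂P :=
        integral_tiedDownMeasure γ hM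
          (.of_bound hmeas.aestronglyMeasurable ‖h‖ (ae_of_all _ hbdd))
    _ = ∫ ω, ∫ t in Icc 0 1, h ((M ω).dilate γ t).toOne ∂(M ω).measure ∂P := by
        refine integral_congr_ae ?_
        filter_upwards [hMcont] with ω hω
        exact integral_congr_ae (ae_of_all _ fun t =>
          heq _ (continuous_dilate_toOne hω γ t))

end TiedDownMeasure

/-! ### Convergence of the laws at visits -/

theorem IsTiedDownLaw.eq {Ω : Type*} [MeasurableSpace Ω] {P : Measure Ω} {M : Ω → DInf} {γ : ℝ}
    {W W' : ProbabilityMeasure DOne} (hW : IsTiedDownLaw γ P M W) (hW' : IsTiedDownLaw γ P M W') :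
    W = W' :=
  Subtype.ext (ext_of_forall_integral_boundedContinuous_eq (μ := (W : Measure DOne))
    (ν := (W' : Measure DOne)) fun h => (hW h).trans (hW' h).symm)

section Convergence

variable {X Ω : Type*} [MeasurableSpace X] [MeasurableSpace Ω] {m : Measure X} [SigmaFinite m]
  {T : X → X} {a : ℕ → ℝ≥0} {R : Set (Set X)} {P : Measure Ω} [IsProbabilityMeasure P]
  {M : Ω → DInf} {γ : ℝ} {A B : Set X} {f : X → ℝ≥0} {g : DOne → ℝ}

theorem tendsto_integral_visitLaw (hT : IsWeaklyRationallyErgodic m T a R)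
    (hreg : IsLocallyUniformlyRegularlyVarying γ a) (hM : Measurable M)
    (hMcont : ∀ᵐ ω ∂P, Continuous (M ω).toFun) (hM0 : ∀ᵐ ω ∂P, M ω 0 = 0)
    (hconv : HasStrongLimit m T a P M) [IsProbabilityMeasure (tiedDownMeasure γ P hM)]
    (hA : A ∈ R) (hB : B ∈ R) (hf : IsL1Pos m f) (hg : IsCBc g) :
    Tendsto (fun n => ∫ ξ, g ξ ∂visitLaw m T a f A B n) atTop (𝓝 (m.real A * m.real B *
      ∫ ξ, g (ξ.scale (integ m f)) ∂tiedDownMeasure γ P hM)) := by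
  obtain ⟨C, hC⟩ := hg.bounded
  have hA' := (hT.measure_lt_top A hA).ne
  have hc : m A * m B ≠ ∞ := ENNReal.mul_ne_top hA' (hT.measure_lt_top B hB).ne
  have hscale : Measurable (NonDec.scale (I := UnitI) (integ m f)) := measurable_scale _
  set μ := (m A * m B) • (tiedDownMeasure γ P hM).map (NonDec.scale (integ m f)) with hμ
  have hμfin : IsFiniteMeasure μ :=
    have := Measure.isProbabilityMeasure_map (μ := tiedDownMeasure γ P hM) hscale.aemeasurable
    Measure.smul_finite _ hc
  have (n : ℕ) : IsFiniteMeasure (visitLaw m T a f A B n) := isFiniteMeasure_visitLaw hA' n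
  have huniv : μ univ = m A * m B := by
    rw [hμ, Measure.smul_apply, Measure.map_apply hscale .univ, preimage_univ, measure_univ,
      smul_eq_mul, mul_one]
  have hfatou {h : DOne → ℝ≥0∞} (hh : Measurable h)
      (hh' : ∀ ξ : DOne, Continuous ξ.toFun → ContinuousAt h ξ) (r : ℝ≥0∞)
      (hr : r < ∫⁻ ξ, h ξ ∂μ) : ∀ᶠ n in atTop, r < ∫⁻ ξ, h ξ ∂visitLaw m T a f A B n := by
    rw [hμ, lintegral_smul_measure, lintegral_map hh hscale,
      lintegral_tiedDownMeasure γ hM (h := fun ξ => h (ξ.scale _)) (hh.comp hscale)] at hr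
    exact eventually_lt_lintegral_visitLaw hT hreg hM hMcont hM0 hconv hA hB hf hh
      (fun ξ hξ => (hh' ξ hξ).lowerSemicontinuousAt) hr
  have hlim := tendsto_integral_of_eventually_lt_lintegral (L := atTop) hg.measurable hC
    (huniv ▸ tendsto_visitLaw_univ hT hA hB hf.1)
    (hfatou (hg.measurable.const_add C).ennreal_ofReal fun ξ hξ =>
      ENNReal.continuous_ofReal.continuousAt.comp (continuousAt_const.add (hg.continuousAt ξ hξ)))
    (hfatou (hg.measurable.const_sub C).ennreal_ofReal fun ξ hξ =>
      ENNReal.continuous_ofReal.continuousAt.comp (continuousAt_const.sub (hg.continuousAt ξ hξ)))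
  rwa [hμ, integral_smul_measure, integral_map hscale.aemeasurable
    hg.measurable.aestronglyMeasurable, ENNReal.toReal_mul, smul_eq_mul] at hlim

end Convergence

end TiedDown

end

open TiedDown

theorem proposition4_general {X : Type*} [MeasurableSpace X] (m : Measure X) [SigmaFinite m]
    (hm : m ≠ 0) (T : X → X) (a : ℕ → ℝ≥0) (R : Set (Set X))
    (hT : IsWeaklyRationallyErgodic m T a R) (γ : ℝ) (ha : IsRegularlyVarying γ a)
    {Ω : Type*} [MeasurableSpace Ω] (P : Measure Ω) [IsProbabilityMeasure P]
    (M : Ω → DInf) (hM : Measurable M) (hMcont : ∀ᵐ ω ∂P, Continuous (M ω).toFun)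
    (hM0 : ∀ᵐ ω ∂P, M ω 0 = 0)
    (hconv : ∀ f : X → ℝ≥0, IsL1Pos m f →
      StrongDistConv m (Psi T a f) P (fun ω => (M ω).scale (integ m f))) :
    ∃ W : ProbabilityMeasure DOne, IsTiedDownLaw γ P M W ∧
      (∀ W' : ProbabilityMeasure DOne, IsTiedDownLaw γ P M W' → W' = W) ∧
      ∀ A ∈ R, ∀ B ∈ R, ∀ f : X → ℝ≥0, IsL1Pos m f → ∀ g : DOne → ℝ, IsCBc g →
        Tendsto (fun n : ℕ => 1 / (a n : ℝ) * ∑ k ∈ Finset.Icc 1 n,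
            ∫ x in A, g (Psi T a f k x).toOne * B.indicator 1 (T^[k] x) ∂m)
          atTop (𝓝 (m.real A * m.real B *
            ∫ ξ, g (ξ.scale (integ m f)) ∂(W : Measure DOne))) := by
  have hreg := hT.isLocallyUniformlyRegularlyVarying hm ha
  have : IsProbabilityMeasure (tiedDownMeasure γ P hM) :=
    ⟨by rw [tiedDownMeasure_univ, hT.lintegral_limit_one hm hM hMcont hM0 hconv]⟩
  have hlaw := isTiedDownLaw_tiedDownMeasure γ hM hMcont
  refine ⟨_, hlaw, fun W' hW' => hW'.eq hlaw, fun A hA B hB f hf g hg => ?_⟩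
  obtain ⟨C, hC⟩ := hg.bounded
  refine (tendsto_integral_visitLaw hT hreg hM hMcont hM0 hconv hA hB hf hg).congr fun n => ?_
  exact integral_visitLaw hT.measurePreserving.measurable hf.1 (hT.measure_lt_top A hA).ne
    (hT.measurableSet B hB) hg.measurable hC n

theorem proposition4 {X : Type*} [TopologicalSpace X] [PolishSpace X] [MeasurableSpace X]
    [BorelSpace X] (m : Measure X) [SigmaFinite m] [NullSingletonClass m] (hm : m ≠ 0) (T : X → X)
    (a : ℕ → ℝ≥0) (R : Set (Set X)) (hT : IsWeaklyRationallyErgodic m T a R)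
    (γ : ℝ) (hγ : γ ∈ Ioc (0 : ℝ) 1) (ha : IsRegularlyVarying γ a)
    {Ω : Type*} [MeasurableSpace Ω] (P : Measure Ω) [IsProbabilityMeasure P]
    (M : Ω → DInf) (hM : Measurable M) (hMcont : ∀ᵐ ω ∂P, Continuous (M ω).toFun)
    (hM0 : ∀ᵐ ω ∂P, M ω 0 = 0)
    (hconv : ∀ f : X → ℝ≥0, IsL1Pos m f →
      StrongDistConv m (Psi T a f) P (fun ω => (M ω).scale (integ m f))) :
    ∃ W : ProbabilityMeasure DOne, IsTiedDownLaw γ P M W ∧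
      (∀ W' : ProbabilityMeasure DOne, IsTiedDownLaw γ P M W' → W' = W) ∧
      ∀ A ∈ R, ∀ B ∈ R, ∀ f : X → ℝ≥0, IsL1Pos m f → ∀ g : DOne → ℝ, IsCBc g →
        Tendsto (fun n : ℕ => 1 / (a n : ℝ) * ∑ k ∈ Finset.Icc 1 n,
            ∫ x in A, g (Psi T a f k x).toOne * B.indicator 1 (T^[k] x) ∂m)
          atTop (𝓝 (m.real A * m.real B *
            ∫ ξ, g (ξ.scale (integ m f)) ∂(W : Measure DOne))) := by
  exact proposition4_general m hm T a R hT γ ha P M hM hMcont hM0 hconv
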